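/- Let $q$ be a prime power, $r=(q^2-q)/2$, and let $t,m,\ell$ be integers such that either $q=4$, $1\le t\le 4$, $m=3$, $0\le \ell\le 2$, or $q\ge 5$, $0\le t\le q$, $3\le m\le q-1$, $0\le \ell\le m-1$. List $\mathbb F_q=\{\alpha_1,\dots,\alpha_q\}$ and, without repetition, $\mathbb F_{q^2}=\{\alpha_1,\dots,\alpha_q,\beta_1,\beta_1^q,\dots,\beta_r,\beta_r^q\}$ (such listings exist). Put $e_{i,j}(x)=x^{iq+j}+x^{jq+i}$ for $i\ne j$ and $e_{i,i}(x)=x^{iq+i}$. For $2\le \mu\le q-1$, $0\le\lambda\le\mu-1$ let $V_{\mu,\lambda}$ be the $\mathbb F_q$-span of the $e_{i,j}$ with $0\le i\le j\le \mu-2$ and the $e_{i,\mu-1}$ with $0\le i\le \lambda$, and let $$C_q(t,\mu,\lambda)=\{(f(\alpha_1),\dots,f(\alpha_t),f(\beta_1),\dots,f(\beta_r)) : f\in V_{\mu,\lambda}\}\subseteq\mathbb F_q^{\,n},\qquad n=t+r .$$ Let $\delta=n-\tfrac12\bigl(q(m-1)+\ell+g\bigr)$, where $$g=\begin{cases}\min\{\max\{2(m-2),m+\ell-1\},t\}&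 q\text{ odd},\\ \max\{\min\{m-2,t\},2t-q\}& q\text{ even},\ \ell\le m-2,\\ \max\{\min\{m-1,t\},2t-q\}& q\text{ even},\ \ell=m-1.\end{cases}$$ An $[[n,k,\{d_z,d_x\}]]_q$ asymmetric quantum code is a stabilizer code $Q\subseteq(\mathbb C^q)^{\otimes n}$ of dimension $q^k$ that detects every error $X(a)Z(b)$, $a,b\in\mathbb F_q^n$, with $\mathrm{wt}(a)\le d_x-1$ and $\mathrm{wt}(b)\le d_z-1$, where $\mathrm{wt}$ is the Hamming weight. Then, for every such listing, $C_q(t,2,1)\subsetneq C_q(t,m,\ell)$. Moreover, with $C_1=C_q(t,2,1)^\perp$ and $C_2=C_q(t,m,\ell)$ (Euclidean duals), the standard CSS code of the pair $C_1^\perp\subset C_2$, that is, the span of the states $\sum_{c\in C_2^\perp}|v+c\rangle$ with $v\in C_1$, is an $$\Bigl[\Bigl[\,t+\tfrac{q^2-q}{2},\ \tfrac{m(m-1)}2+\ell-2,\ \{d_z,\ d_x=3\}\Bigr]\Bigr]_q$$ asymmetric quantum code, where $d_z=\mathrm{wt}(C_2\setminus C_1^\perp)\ge\delta$ and $d_x=\mathrm{wt}(C_1\setminus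 C_2^\perp)=3$ (the minimum Hamming weights of these sets). Both distances are exact: some bit-flip error $X(a)$ with $\mathrm{wt}(a)=3$ and some phase-flip error $Z(b)$ with $\mathrm{wt}(b)=d_z$ are not detected. -/

import Mathlib

open Polynomial

noncomputable section

/-! ### Linear codes -/

/-- The Euclidean dual `C^⊥` of a linear code. -/
def dualCode {F : Type*} [Field F] {n : ℕ} (C : Submodule F (Fin n → F)) :
    Submodule F (Fin n → F) where
  carrier := {u | ∀ v ∈ C, u ⬝ᵥ v = 0}
  zero_mem' := by intro v _; simp
  add_mem' := by
    intro a b ha hb v hv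
    rw [add_dotProduct, ha v hv, hb v hv, add_zero]
  smul_mem' := by
    intro c a ha v hv
    rw [smul_dotProduct, ha v hv, smul_zero]

/-- `wt(C \ D) = d`: the minimum Hamming weight of the words of `C` outside `D` is attained
and equals `d`. -/
def IsRelMinWeight {F : Type*} [Field F] [DecidableEq F] {n : ℕ}
    (C D : Submodule F (Fin n → F)) (d : ℕ) : Prop :=
  IsLeast {w : ℕ | ∃ u ∈ C, u ∉ D ∧ hammingNorm u = w} d

/-! ### Quantum codes -/

/-- The Hilbert space `(ℂ^q)^{⊗ n}`, with orthonormal computational basis `|x⟩`, `x ∈ F_q^n`. -/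
abbrev QuditSpace (F : Type*) (n : ℕ) : Type _ := EuclideanSpace ℂ (Fin n → F)

/-- The canonical additive character `x ↦ exp (2 π i Tr(x) / p)` of a finite field of
characteristic `p`, where `Tr` is the absolute trace to the prime field. -/
def stdChar (F : Type*) [Field F] [Fintype F] (x : F) : ℂ :=
  letI : Algebra (ZMod (ringChar F)) F := ZMod.algebra F (ringChar F)
  Complex.exp (2 * Real.pi * Complex.I *
    ((Algebra.trace (ZMod (ringChar F)) F x).val : ℂ) / (ringChar F : ℂ))

/-- The error operator `X(a) Z(b)`, where `X(a)|x⟩ = |x + a⟩` and `Z(b)|x⟩ = χ(b · x)|x⟩`.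
Thus `X(a) Z(b)|x⟩ = χ(b · x)|x + a⟩`; on amplitudes this is the formula below. -/
def errorOp {F : Type*} [Field F] [Fintype F] {n : ℕ} (a b : Fin n → F) :
    QuditSpace F n →ₗ[ℂ] QuditSpace F n where
  toFun ψ := WithLp.toLp 2 fun y => stdChar F (b ⬝ᵥ (y - a)) * ψ (y - a)
  map_add' ψ φ := by ext y; simp [mul_add]
  map_smul' c ψ := by ext y; simp [mul_left_comm]

/-- The code `Q` detects the error `E`: `P E P = λ P` for some scalar `λ`, where `P` is the
orthogonal projection onto `Q`, written in terms of inner products. -/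
def Detects {F : Type*} [Fintype F] {n : ℕ} (Q : Submodule ℂ (QuditSpace F n))
    (E : QuditSpace F n →ₗ[ℂ] QuditSpace F n) : Prop :=
  ∃ c : ℂ, ∀ φ ∈ Q, ∀ ψ ∈ Q, inner ℂ φ (E ψ) = c * inner ℂ φ ψ

/-- `Q` is a stabilizer code: a nonzero space that is the joint `+1` eigenspace of an abelian
group of (scalar multiples of) error operators. -/
def IsStabilizerCode {F : Type*} [Field F] [Fintype F] {n : ℕ}
    (Q : Submodule ℂ (QuditSpace F n)) : Prop :=
  Q ≠ ⊥ ∧ ∃ S : Subgroup (QuditSpace F n ≃ₗ[ℂ] QuditSpace F n),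
    (∀ g ∈ S, ∃ (γ : ℂ) (a b : Fin n → F), ∀ ψ, g ψ = γ • errorOp a b ψ) ∧
    (∀ g ∈ S, ∀ h ∈ S, g * h = h * g) ∧
    ∀ ψ, ψ ∈ Q ↔ ∀ g ∈ S, g ψ = ψ

/-- `Q` is an `[[n, k, {d_z, d_x}]]_q` asymmetric quantum code: a stabilizer code of dimension
`q^k` that detects every error with at most `d_x - 1` bit-flips and, simultaneously, at most
`d_z - 1` phase-flips. -/
structure IsAQC {F : Type*} [Field F] [Fintype F] [DecidableEq F] {n : ℕ}
    (Q : Submodule ℂ (QuditSpace F n)) (k dz dx : ℕ) : Prop where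
  stabilizer : IsStabilizerCode Q
  dim : Module.finrank ℂ Q = Fintype.card F ^ k
  dz_pos : 1 ≤ dz
  dx_pos : 1 ≤ dx
  detects : ∀ a b : Fin n → F, hammingNorm a < dx → hammingNorm b < dz → Detects Q (errorOp a b)

/-- The distances `d_z` and `d_x` of `Q` cannot be increased: some bit-flip error of weight
exactly `d_x` and some phase-flip error of weight exactly `d_z` are not detected. -/
def DistancesSharp {F : Type*} [Field F] [Fintype F] [DecidableEq F] {n : ℕ}
    (Q : Submodule ℂ (QuditSpace F n)) (dz dx : ℕ) : Prop :=
  (∃ a : Fin n → F, hammingNorm a = dx ∧ ¬ Detects Q (errorOp a 0)) ∧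
  (∃ b : Fin n → F, hammingNorm b = dz ∧ ¬ Detects Q (errorOp 0 b))

/-- The (unnormalized) coset state `|v + W⟩ = ∑_{w ∈ W} |v + w⟩`. -/
def cosetState {F : Type*} [Field F] {n : ℕ} (W : Submodule F (Fin n → F)) (v : Fin n → F) :
    QuditSpace F n :=
  WithLp.toLp 2 (Set.indicator {x | x - v ∈ W} 1)

/-- The standard CSS code of a pair `C₁^⊥ ⊆ C₂` (equivalently `C₂^⊥ ⊆ C₁`): the span of the
coset states `|v + C₂^⊥⟩` with `v ∈ C₁`. Bit-flips are controlled by `C₁ \ C₂^⊥`,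
phase-flips by `C₂ \ C₁^⊥`. -/
def cssCode {F : Type*} [Field F] {n : ℕ} (C₁ C₂ : Submodule F (Fin n → F)) :
    Submodule ℂ (QuditSpace F n) :=
  Submodule.span ℂ (cosetState (dualCode C₂) '' (C₁ : Set (Fin n → F)))

/-! ### Xing-Ling codes -/

/-- The polynomials `e_{i,j}`: `x^{iq+j} + x^{jq+i}` if `i ≠ j`, and `x^{iq+i}` if `i = j`. -/
def xlPoly (F : Type*) [Field F] (q i j : ℕ) : F[X] :=
  if i = j then X ^ (i * q + j) else X ^ (i * q + j) + X ^ (j * q + i)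

/-- The space `V_{m,ℓ}`, spanned over `F_q` by the `e_{i,j}` with `0 ≤ i ≤ j ≤ m - 2` and the
`e_{i,m-1}` with `0 ≤ i ≤ ℓ`. -/
def xlSpace (F : Type*) [Field F] (q m l : ℕ) : Submodule F F[X] :=
  Submodule.span F {f | ∃ i j, f = xlPoly F q i j ∧ ((i ≤ j ∧ j + 2 ≤ m) ∨ (i ≤ l ∧ j + 1 = m))}

/-- `α_1, …, α_q` lists `F_q`, and `α_1, …, α_q, β_1, β_1^q, …, β_r, β_r^q` lists
`K = F_{q^2}` without repetition, where `r = (q² - q)/2`. -/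
structure IsXLListing {F K : Type*} [Field F] [Field K] [Algebra F K] {q : ℕ}
    (α : Fin q → F) (β : Fin ((q ^ 2 - q) / 2) → K) : Prop where
  bijective_base : Function.Bijective α
  bijective_all : Function.Bijective
    (Sum.elim (fun i => algebraMap F K (α i)) (Sum.elim β fun j => β j ^ q) :
      Fin q ⊕ (Fin ((q ^ 2 - q) / 2) ⊕ Fin ((q ^ 2 - q) / 2)) → K)

/-- The evaluation points `(α_1, …, α_t, β_1, …, β_r)`. -/
def xlPoints {F K : Type*} [Field F] [Field K] [Algebra F K] {q t : ℕ} (ht : t ≤ q)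
    (α : Fin q → F) (β : Fin ((q ^ 2 - q) / 2) → K) : Fin (t + (q ^ 2 - q) / 2) → K :=
  Fin.append (fun i : Fin t => algebraMap F K (α (Fin.castLE ht i))) β

/-- The Xing-Ling code `C_q(t, m, ℓ)`: all words `(f(α_1), …, f(α_t), f(β_1), …, f(β_r))` with
`f ∈ V_{m,ℓ}`. The values lie in `F_q` (see `aeval_mem_range_of_mem_xlSpace`) and are regarded
as elements of `F_q`. -/
def xlCode {F K : Type*} [Field F] [Field K] [Algebra F K] {q t : ℕ} (ht : t ≤ q)
    (α : Fin q → F) (β : Fin ((q ^ 2 - q) / 2) → K) (m l : ℕ) :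
    Submodule F (Fin (t + (q ^ 2 - q) / 2) → F) where
  carrier := {c | ∃ f ∈ xlSpace F q m l, ∀ i, algebraMap F K (c i) = aeval (xlPoints ht α β i) f}
  zero_mem' := ⟨0, Submodule.zero_mem _, by simp⟩
  add_mem' := by
    rintro a b ⟨f, hf, hfa⟩ ⟨g, hg, hgb⟩
    exact ⟨f + g, Submodule.add_mem _ hf hg, fun i => by simp [hfa, hgb]⟩
  smul_mem' := by
    rintro c a ⟨f, hf, hfa⟩
    exact ⟨c • f, Submodule.smul_mem _ c hf, fun i => by simp [hfa, Algebra.smul_def]⟩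

/-- The polynomials of `V_{m,ℓ}` take values in `F_q` on all of `F_{q^2}`, so that `xlCode`
loses no word. -/
theorem aeval_mem_range_of_mem_xlSpace {F K : Type*} [Field F] [Fintype F] [Field K] [Algebra F K]
    {q : ℕ} (hq : Fintype.card F = q) (hK : Module.finrank F K = 2) {m l : ℕ} {f : F[X]}
    (hf : f ∈ xlSpace F q m l) (a : K) : aeval a f ∈ Set.range (algebraMap F K) := by
  subst hq
  have : Module.Finite F K := Module.finite_of_finrank_pos (by omega)
  have : Finite K := Module.finite_of_finite F
  have := Fintype.ofFinite K
  have hcard : Fintype.card K = Fintype.card F ^ 2 := by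
    rw [Module.card_eq_pow_finrank (K := F), hK]
  have hqq : ∀ z : K, (z ^ Fintype.card F) ^ Fintype.card F = z := fun z => by
    rw [← pow_mul, ← sq, ← hcard, FiniteField.pow_card]
  have hfix : ∀ y : K, y ^ Fintype.card F = y → y ∈ Set.range (algebraMap F K) := by
    intro y hy
    have hm : (X ^ Fintype.card F - X : F[X]).Monic := by
      apply monic_X_pow_sub
      rw [degree_X]
      exact_mod_cast Fintype.one_lt_card
    have hp : ((X ^ Fintype.card F - X : F[X]).roots.map fun c => X - C c).prod
        = X ^ Fintype.card F - X := by
      apply prod_multiset_X_sub_C_of_monic_of_roots_card_eq hm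
      rw [FiniteField.roots_X_pow_card_sub_X,
        FiniteField.X_pow_card_sub_X_natDegree_eq F Fintype.one_lt_card]
      rfl
    rw [FiniteField.roots_X_pow_card_sub_X] at hp
    change ∏ c : F, (X - C c) = _ at hp
    have h := congrArg (aeval y) hp
    simp only [map_prod, map_sub, aeval_X, aeval_C, map_pow, hy, sub_self] at h
    obtain ⟨c, -, hc⟩ := Finset.prod_eq_zero_iff.mp h
    exact ⟨c, (sub_eq_zero.mp hc).symm⟩
  have key : ∀ i j : ℕ, (a ^ (i * Fintype.card F + j)) ^ Fintype.card F
      = a ^ (j * Fintype.card F + i) := by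
    intro i j
    have e : ∀ u v : ℕ, a ^ (u * Fintype.card F + v) = (a ^ Fintype.card F) ^ u * a ^ v :=
      fun u v => by rw [pow_add, mul_comm u, pow_mul]
    rw [e, e, mul_pow, ← pow_mul, mul_comm i, pow_mul, hqq, ← pow_mul, mul_comm j, pow_mul,
      mul_comm]
  have hadd : ∀ y z : K, (y + z) ^ Fintype.card F = y ^ Fintype.card F + z ^ Fintype.card F :=
    fun y z => map_add (FiniteField.frobeniusAlgHom F K) y z
  induction hf using Submodule.span_induction with
  | mem g hg =>
    obtain ⟨i, j, rfl, -⟩ := hg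
    apply hfix
    unfold xlPoly
    split_ifs with hij
    · subst hij
      simp only [map_pow, aeval_X, key]
    · simp only [map_add, map_pow, aeval_X, hadd, key]
      exact add_comm _ _
  | zero => exact ⟨0, by simp⟩
  | add g h _ _ hg hh =>
    obtain ⟨c, hc⟩ := hg
    obtain ⟨d, hd⟩ := hh
    exact ⟨c + d, by simp [hc, hd]⟩
  | smul c g _ hg =>
    obtain ⟨d, hd⟩ := hg
    exact ⟨c * d, by simp [hd, Algebra.smul_def]⟩

/-- The integer `g` entering the designed distance of `C_q(t, m, ℓ)`. -/
def xlG (q t m l : ℕ) : ℤ :=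
  if Odd q then min (max (2 * ((m : ℤ) - 2)) ((m : ℤ) + l - 1)) t
  else if (l : ℤ) ≤ (m : ℤ) - 2 then max (min ((m : ℤ) - 2) t) (2 * (t : ℤ) - q)
  else max (min ((m : ℤ) - 1) t) (2 * (t : ℤ) - q)

/-- The designed distance `δ = n - (q (m - 1) + ℓ + g) / 2` of `C_q(t, m, ℓ)`, where
`n = t + (q² - q)/2`; it may be a half-integer. -/
def xlDelta (q t m l : ℕ) : ℚ :=
  ((t : ℚ) + ((q : ℚ) ^ 2 - q) / 2) - ((q : ℚ) * ((m : ℚ) - 1) + l + xlG q t m l) / 2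

end

/-! ### Dual codes -/

section Dual

variable {F : Type*} [Field F] {n : ℕ}

/-! The quantum half holds for any pair C₁^⊥ ⊆ C₂. States of the CSS code are the functions
supported on C₁ and invariant under C₂^⊥ (`mem_cssCode_iff`). Support is a condition on Z-type
operators and invariance one on X-type operators, which gives the stabilizer. The dimension counts
cosets. An error goes undetected only if a ∈ C₁ \ C₂^⊥ or b ∈ C₂ \ C₁^⊥, and pure errors of these
kinds are indeed undetected (`isAQC_and_distancesSharp_cssCode`).

The bound on d_z is a root count. A polynomial f over F_q vanishes at β_j^q whenever it vanishes at
β_j, so zeros at the β_j count twice against deg f ≤ q(m-1)+ℓ. Zeros in F_q are controlled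
separately: there x^q = x, so f agrees with a polynomial of low degree (q odd) or with the square of
one (q even). If that polynomial is zero, f vanishes on all of F_q, doubly when q is odd, which
costs enough degree (`two_mul_card_zeros_le`). The same count shows that evaluation is injective on
V_{m,ℓ}, hence the dimensions (`finrank_xlCode`).

For d_x = 3, the code C_q(t,2,1) is spanned by the constant 1, the trace and the norm of the points.
Trace and norm determine a point up to conjugation, so no word of weight 1 or 2 is orthogonal to it.
Three points (trace, norm) on a non-vertical line carry a word of weight 3, which a Vandermonde
determinant keeps out of C₂^⊥. Such a line comes from pigeonhole (`exists_weight_three`). -/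

theorem mem_dualCode {C : Submodule F (Fin n → F)} {u : Fin n → F} :
    u ∈ dualCode C ↔ ∀ v ∈ C, u ⬝ᵥ v = 0 := Iff.rfl

theorem toBilin'_one_apply (u v : Fin n → F) :
    Matrix.toBilin' (1 : Matrix (Fin n) (Fin n) F) u v = u ⬝ᵥ v := by
  rw [Matrix.toBilin'_apply', Matrix.one_mulVec]

theorem toBilin'_one_isRefl : (Matrix.toBilin' (1 : Matrix (Fin n) (Fin n) F)).IsRefl := by
  intro u v h
  rw [toBilin'_one_apply] at h ⊢
  rwa [dotProduct_comm]

theorem toBilin'_one_nondegenerate :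
    (Matrix.toBilin' (1 : Matrix (Fin n) (Fin n) F)).Nondegenerate :=
  LinearMap.BilinForm.nondegenerate_toBilin'_of_det_ne_zero' _ (by simp)

/-- Places Euclidean duality under the theory of nondegenerate reflexive bilinear forms, which
yields the double dual and the dimension formula. -/
theorem dualCode_eq_orthogonal (C : Submodule F (Fin n → F)) :
    dualCode C = (Matrix.toBilin' (1 : Matrix (Fin n) (Fin n) F)).orthogonal C := by
  ext u
  rw [mem_dualCode, LinearMap.BilinForm.mem_orthogonal_iff]
  refine forall₂_congr fun v _ => ?_
  rw [toBilin'_one_apply, dotProduct_comm]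

theorem dualCode_dualCode (C : Submodule F (Fin n → F)) : dualCode (dualCode C) = C := by
  rw [dualCode_eq_orthogonal, dualCode_eq_orthogonal,
    LinearMap.BilinForm.orthogonal_orthogonal toBilin'_one_nondegenerate toBilin'_one_isRefl]

theorem finrank_dualCode (C : Submodule F (Fin n → F)) :
    Module.finrank F (dualCode C) = n - Module.finrank F C := by
  rw [dualCode_eq_orthogonal,
    LinearMap.BilinForm.finrank_orthogonal toBilin'_one_nondegenerate]
  simp

theorem dualCode_anti {C D : Submodule F (Fin n → F)} (h : C ≤ D) : dualCode D ≤ dualCode C :=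
  fun _ hu v hv => hu v (h hv)

theorem dotProduct_eq_zero_of_mem_dualCode {C : Submodule F (Fin n → F)} {u v : Fin n → F}
    (hu : u ∈ C) (hv : v ∈ dualCode C) : u ⬝ᵥ v = 0 := by
  rw [dotProduct_comm]
  exact hv u hu

theorem exists_dotProduct_ne_zero {C : Submodule F (Fin n → F)} {u : Fin n → F} (hu : u ∉ C) :
    ∃ v ∈ dualCode C, u ⬝ᵥ v ≠ 0 := by
  by_contra! h
  rw [← dualCode_dualCode C] at hu
  exact hu h

end Dual

/-! ### The canonical additive character -/

section Character

variable {F : Type*} [Field F] [Fintype F]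

theorem stdChar_eq_stdAddChar (x : F) :
    haveI : NeZero (ringChar F) := ⟨(CharP.char_is_prime F (ringChar F)).ne_zero⟩
    letI : Algebra (ZMod (ringChar F)) F := ZMod.algebra F (ringChar F)
    stdChar F x = ZMod.stdAddChar (Algebra.trace (ZMod (ringChar F)) F x) := by
  have : NeZero (ringChar F) := ⟨(CharP.char_is_prime F (ringChar F)).ne_zero⟩
  rw [ZMod.stdAddChar_apply, ZMod.toCircle_apply]
  rfl

theorem stdChar_add (x y : F) : stdChar F (x + y) = stdChar F x * stdChar F y := by
  simp only [stdChar_eq_stdAddChar, map_add, AddChar.map_add_eq_mul]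

theorem stdChar_zero : stdChar F 0 = 1 := by
  simp only [stdChar_eq_stdAddChar, map_zero, AddChar.map_zero_eq_one]

/-- The trace form is nondegenerate, and the standard character of the prime field is injective. -/
theorem exists_stdChar_mul_ne_one {x : F} (hx : x ≠ 0) : ∃ c : F, stdChar F (c * x) ≠ 1 := by
  let _ : Algebra (ZMod (ringChar F)) F := ZMod.algebra F (ringChar F)
  have : NeZero (ringChar F) := ⟨(CharP.char_is_prime F (ringChar F)).ne_zero⟩
  obtain ⟨c, hc⟩ := FiniteField.trace_to_zmod_nondegenerate F hx
  refine ⟨c, fun h => hc ?_⟩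
  rw [stdChar_eq_stdAddChar, ← AddChar.map_zero_eq_one (ZMod.stdAddChar (N := ringChar F)), mul_comm c x] at h
  exact ZMod.injective_stdAddChar h

/-- A dual word not orthogonal to u can be rescaled inside the dual until the character sees the
product. Every phase argument below rests on this. -/
theorem exists_mem_dualCode_stdChar_ne_one {n : ℕ} {C : Submodule F (Fin n → F)} {u : Fin n → F}
    (hu : u ∉ C) : ∃ v ∈ dualCode C, stdChar F (u ⬝ᵥ v) ≠ 1 := by
  obtain ⟨v, hv, huv⟩ := exists_dotProduct_ne_zero hu
  obtain ⟨c, hc⟩ := exists_stdChar_mul_ne_one huv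
  exact ⟨c • v, Submodule.smul_mem _ c hv, by rwa [dotProduct_smul, smul_eq_mul]⟩

end Character

/-! ### CSS codes -/

section CosetState

variable {F : Type*} [Field F] {n : ℕ}

theorem cosetState_apply (W : Submodule F (Fin n → F)) (v y : Fin n → F) [Decidable (y - v ∈ W)] :
    cosetState W v y = if y - v ∈ W then 1 else 0 := by
  classical
  change Set.indicator {x | x - v ∈ W} 1 y = _
  rw [Set.indicator_apply]
  simp only [Set.mem_ofPred_eq, Pi.one_apply]

theorem cosetState_self (W : Submodule F (Fin n → F)) (v : Fin n → F) : cosetState W v v = 1 := by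
  classical
  rw [cosetState_apply, if_pos (by simp)]

theorem cosetState_ne_zero (W : Submodule F (Fin n → F)) (v : Fin n → F) :
    cosetState W v ≠ 0 := by
  intro h
  have := cosetState_self W v
  rw [h] at this
  simp at this

theorem cosetState_mem_cssCode {C₁ C₂ : Submodule F (Fin n → F)} {v : Fin n → F} (hv : v ∈ C₁) :
    cosetState (dualCode C₂) v ∈ cssCode C₁ C₂ :=
  Submodule.subset_span ⟨v, hv, rfl⟩

end CosetState

theorem inner_eq_sum {F : Type*} [Fintype F] {n : ℕ} (φ ψ : QuditSpace F n) :
    inner ℂ φ ψ = ∑ y, ψ y * starRingEnd ℂ (φ y) := by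
  simp [PiLp.inner_apply]

section CSS

variable {F : Type*} [Field F] [Fintype F] {n : ℕ}

theorem errorOp_apply (a b : Fin n → F) (ψ : QuditSpace F n) (y : Fin n → F) :
    errorOp a b ψ y = stdChar F (b ⬝ᵥ (y - a)) * ψ (y - a) := rfl

/-- In general the two sides differ by the phase χ(b · a'), from moving Z(b) past X(a'). -/
theorem errorOp_mul (a b a' b' : Fin n → F) (h : b ⬝ᵥ a' = 0) (ψ : QuditSpace F n) :
    errorOp a b (errorOp a' b' ψ) = errorOp (a + a') (b + b') ψ := by
  ext y
  rw [errorOp_apply, errorOp_apply, errorOp_apply, ← mul_assoc, ← stdChar_add, sub_sub]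
  congr 2
  rw [add_dotProduct, dotProduct_sub, dotProduct_sub b, dotProduct_add b, h, add_zero]

theorem errorOp_zero_zero (ψ : QuditSpace F n) : errorOp 0 0 ψ = ψ := by
  ext y
  simp [errorOp_apply, stdChar_zero]

/-- The error `X(a) Z(b)` with `b ⬝ a = 0`, as an invertible operator. -/
noncomputable def errorEquiv (a b : Fin n → F) (h : b ⬝ᵥ a = 0) : QuditSpace F n ≃ₗ[ℂ] QuditSpace F n :=
  LinearEquiv.ofLinearMap (errorOp a b) (errorOp (-a) (-b))
    (by
      ext1 ψ
      change errorOp a b (errorOp (-a) (-b) ψ) = ψ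
      rw [errorOp_mul _ _ _ _ (by simp [h]), add_neg_cancel, add_neg_cancel, errorOp_zero_zero])
    (by
      ext1 ψ
      change errorOp (-a) (-b) (errorOp a b ψ) = ψ
      rw [errorOp_mul _ _ _ _ (by simp [h]), neg_add_cancel, neg_add_cancel, errorOp_zero_zero])

theorem errorEquiv_apply (a b : Fin n → F) (h : b ⬝ᵥ a = 0) (ψ : QuditSpace F n) :
    errorEquiv a b h ψ = errorOp a b ψ := rfl

/-- The group of the errors `X(a) Z(b)` with `a ∈ W` and `b ∈ D`, where `W ⊆ D^⊥`. -/
noncomputable def cssStabilizer (D W : Submodule F (Fin n → F)) (h : W ≤ dualCode D) :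
    Subgroup (QuditSpace F n ≃ₗ[ℂ] QuditSpace F n) where
  carrier := {g | ∃ a ∈ W, ∃ b ∈ D, ∀ ψ, g ψ = errorOp a b ψ}
  one_mem' := ⟨0, W.zero_mem, 0, D.zero_mem, fun ψ => (errorOp_zero_zero ψ).symm⟩
  mul_mem' := by
    rintro g g' ⟨a, ha, b, hb, hg⟩ ⟨a', ha', b', hb', hg'⟩
    refine ⟨a + a', W.add_mem ha ha', b + b', D.add_mem hb hb', fun ψ => ?_⟩
    rw [LinearEquiv.mul_apply, hg, hg', errorOp_mul]
    exact dotProduct_eq_zero_of_mem_dualCode hb (h ha')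
  inv_mem' := by
    rintro g ⟨a, ha, b, hb, hg⟩
    refine ⟨-a, W.neg_mem ha, -b, D.neg_mem hb, fun ψ => ?_⟩
    have hab : b ⬝ᵥ a = 0 := dotProduct_eq_zero_of_mem_dualCode hb (h ha)
    obtain ⟨φ, rfl⟩ := g.surjective ψ
    have : g⁻¹ (g φ) = φ := g.symm_apply_apply φ
    rw [this, hg, errorOp_mul _ _ _ _ (by simp [hab]), neg_add_cancel, neg_add_cancel,
      errorOp_zero_zero]

variable {C₁ C₂ : Submodule F (Fin n → F)}

/-- The states of the CSS code are the states supported on `C₁` and invariant under translation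
by `C₂^⊥`. -/
theorem mem_cssCode_iff (h : dualCode C₂ ≤ C₁) (ψ : QuditSpace F n) :
    ψ ∈ cssCode C₁ C₂ ↔
      (∀ y, ∀ w ∈ dualCode C₂, ψ (y + w) = ψ y) ∧ ∀ y, y ∉ C₁ → ψ y = 0 := by
  classical
  constructor
  · intro hψ
    induction hψ using Submodule.span_induction with
    | mem x hx =>
      obtain ⟨v, hv, rfl⟩ := hx
      constructor
      · intro y w hw
        rw [cosetState_apply, cosetState_apply, add_sub_right_comm]
        simp only [Submodule.add_mem_iff_left _ hw]
      · intro y hy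
        rw [cosetState_apply, if_neg]
        intro hyv
        apply hy
        have := C₁.add_mem (h hyv) hv
        rwa [sub_add_cancel] at this
    | zero => exact ⟨fun _ _ _ => rfl, fun _ _ => rfl⟩
    | add x y _ _ hx hy =>
      exact ⟨fun z w hw => by rw [PiLp.add_apply, PiLp.add_apply, hx.1 z w hw, hy.1 z w hw],
        fun z hz => by rw [PiLp.add_apply, hx.2 z hz, hy.2 z hz, add_zero]⟩
    | smul c x _ hx =>
      exact ⟨fun z w hw => by rw [PiLp.smul_apply, PiLp.smul_apply, hx.1 z w hw],
        fun z hz => by rw [PiLp.smul_apply, hx.2 z hz, smul_zero]⟩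
  · rintro ⟨hinv, hsupp⟩
    have hcard : ((Finset.univ.filter fun w => w ∈ dualCode C₂).card : ℂ) ≠ 0 := by
      rw [Nat.cast_ne_zero, Finset.card_ne_zero]
      exact ⟨0, by simp⟩
    -- In ∑ ψ(v)|v + C₂^⊥⟩ the amplitude at y collects ψ(y - w) = ψ(y) once for each w ∈ C₂^⊥, so
    -- dividing by the order of C₂^⊥ recovers ψ.
    have key : ψ = ((Finset.univ.filter fun w => w ∈ dualCode C₂).card : ℂ)⁻¹ •
        ∑ v, ψ v • cosetState (dualCode C₂) v := by
      ext y
      rw [PiLp.smul_apply, WithLp.ofLp_sum, Finset.sum_apply, smul_eq_mul, eq_inv_mul_iff_mul_eq₀ hcard]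
      simp only [WithLp.ofLp_smul, Pi.smul_apply, cosetState_apply, smul_eq_mul, mul_ite, mul_one,
        mul_zero]
      rw [← Finset.sum_filter, ← nsmul_eq_mul, ← Finset.sum_const]
      refine Finset.sum_bij (fun w _ => y - w) ?_ ?_ ?_ ?_
      · intro w hw
        simpa using hw
      · intro w _ w' _ hww
        simpa using hww
      · intro v hv
        exact ⟨y - v, by simpa using hv, by simp⟩
      · intro w hw
        have := hinv (y - w) w (by simpa using hw)
        rwa [sub_add_cancel] at this
    rw [key]
    refine Submodule.smul_mem _ _ (Submodule.sum_mem _ fun v _ => ?_)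
    by_cases hv : v ∈ C₁
    · exact Submodule.smul_mem _ _ (Submodule.subset_span ⟨v, hv, rfl⟩)
    · rw [hsupp v hv, zero_smul]
      exact Submodule.zero_mem _

/-- The stabilizer consists of X(a)Z(b) with a ∈ C₂^⊥ and b ∈ C₁^⊥. Its X-part forces invariance
under C₂^⊥; its Z-part forces support in C₁, because a point outside C₁ is detected by a character
of C₁^⊥. -/
theorem isStabilizerCode_cssCode (h : dualCode C₂ ≤ C₁) : IsStabilizerCode (cssCode C₁ C₂) := by
  have h' : dualCode C₂ ≤ dualCode (dualCode C₁) := by rwa [dualCode_dualCode]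
  refine ⟨fun hbot => ?_, cssStabilizer (dualCode C₁) (dualCode C₂) h', ?_, ?_, ?_⟩
  · have := cosetState_mem_cssCode (C₂ := C₂) C₁.zero_mem
    rw [hbot, Submodule.mem_bot] at this
    exact cosetState_ne_zero _ _ this
  · rintro g ⟨a, -, b, -, hg⟩
    exact ⟨1, a, b, fun ψ => by rw [hg, one_smul]⟩
  · rintro g ⟨a, ha, b, hb, hg⟩ g' ⟨a', ha', b', hb', hg'⟩
    ext1 ψ
    rw [LinearEquiv.mul_apply, LinearEquiv.mul_apply, hg, hg', hg', hg,
      errorOp_mul _ _ _ _ (dotProduct_eq_zero_of_mem_dualCode hb (h' ha')),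
      errorOp_mul _ _ _ _ (dotProduct_eq_zero_of_mem_dualCode hb' (h' ha)),
      add_comm a, add_comm b]
  · intro ψ
    rw [mem_cssCode_iff h]
    constructor
    · rintro ⟨hinv, hsupp⟩ g ⟨a, ha, b, hb, hg⟩
      rw [hg]
      ext y
      have hy : ψ (y - a) = ψ y := by
        have := hinv (y - a) a ha
        rw [sub_add_cancel] at this
        exact this.symm
      rw [errorOp_apply]
      by_cases hyC : y - a ∈ C₁
      · rw [hb _ hyC, stdChar_zero, one_mul, hy]
      · rw [← hy, hsupp _ hyC, mul_zero]
    · intro hfix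
      constructor
      · intro y w hw
        have := hfix (errorEquiv w 0 (by simp)) ⟨w, hw, 0, Submodule.zero_mem _, fun _ => rfl⟩
        rw [errorEquiv_apply] at this
        have := congrArg (fun φ : QuditSpace F n => φ (y + w)) this
        simp only [errorOp_apply, zero_dotProduct, stdChar_zero, one_mul, add_sub_cancel_right]
          at this
        exact this.symm
      · intro y hy
        obtain ⟨b, hb, hby⟩ := exists_mem_dualCode_stdChar_ne_one hy
        have := hfix (errorEquiv 0 b (by simp)) ⟨0, Submodule.zero_mem _, b, hb, fun _ => rfl⟩
        rw [errorEquiv_apply] at this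
        have := congrArg (fun φ : QuditSpace F n => φ y) this
        simp only [errorOp_apply, sub_zero] at this
        by_contra h0
        rw [dotProduct_comm] at hby
        exact hby (mul_right_cancel₀ h0 (by rw [this, one_mul]))

/-- Coset states of distinct cosets have disjoint supports, so one state per element of C₁ / C₂^⊥
forms a basis. -/
theorem finrank_cssCode (h : dualCode C₂ ≤ C₁) :
    Module.finrank ℂ (cssCode C₁ C₂) =
      Fintype.card F ^ (Module.finrank F C₁ - Module.finrank F (dualCode C₂)) := by
  classical
  let N : Submodule F C₁ := (dualCode C₂).comap C₁.subtype
  have := Fintype.ofFinite (C₁ ⧸ N)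
  let s : C₁ ⧸ N → QuditSpace F n := fun x => cosetState (dualCode C₂) (x.out : C₁)
  have hout : ∀ v : C₁, ((N.mkQ v).out : Fin n → F) - v ∈ dualCode C₂ := by
    intro v
    have : N.mkQ ((N.mkQ v).out) = N.mkQ v := Quotient.out_eq _
    exact (Submodule.Quotient.eq N).mp this
  -- Evaluation at the chosen representatives is dual to the family `s`; independence follows at
  -- once.
  have hval : ∀ x y : C₁ ⧸ N, s x (y.out : C₁) = if x = y then 1 else 0 := by
    intro x y
    change cosetState _ _ _ = _
    rw [cosetState_apply]
    congr 1
    have hx : N.mkQ x.out = x := Quotient.out_eq x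
    have hy : N.mkQ y.out = y := Quotient.out_eq y
    rw [eq_iff_iff]
    conv_rhs => rw [eq_comm, ← hx, ← hy]
    exact (Submodule.Quotient.eq N).symm
  have hspan : cssCode C₁ C₂ = Submodule.span ℂ (Set.range s) := by
    unfold cssCode
    congr 1
    ext ψ
    constructor
    · rintro ⟨v, hv, rfl⟩
      refine ⟨N.mkQ ⟨v, hv⟩, ?_⟩
      have hv' := hout ⟨v, hv⟩
      ext y
      change cosetState _ _ _ = _
      rw [cosetState_apply, cosetState_apply]
      congr 1
      rw [eq_iff_iff, ← Submodule.add_mem_iff_left (dualCode C₂) hv']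
      simp
    · rintro ⟨x, rfl⟩
      exact ⟨_, (x.out).2, rfl⟩
  have hli : LinearIndependent ℂ s := by
    rw [Fintype.linearIndependent_iff]
    intro g hg y
    have := congrArg (fun φ : QuditSpace F n => φ (y.out : C₁)) hg
    simp only [WithLp.ofLp_sum, Finset.sum_apply, WithLp.ofLp_smul, Pi.smul_apply, hval] at this
    simpa using this
  rw [hspan, finrank_span_eq_card hli, ← Nat.card_eq_fintype_card,
    Module.natCard_eq_pow_finrank (K := F), Nat.card_eq_fintype_card]
  congr 1
  have h1 := N.finrank_quotient_add_finrank
  have h2 : Module.finrank F N = Module.finrank F (dualCode C₂) :=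
    (Submodule.comapSubtypeEquivOfLe h).finrank_eq
  omega

/-- If a ∉ C₁, the error moves the support off C₁. If a ∈ C₂^⊥ and b ∉ C₂, a phase that varies along
C₂^⊥ averages the inner product to zero. In the remaining case the error fixes the code pointwise.
-/
theorem detects_cssCode (h : dualCode C₂ ≤ C₁) {a b : Fin n → F}
    (ha : a ∈ C₁ → a ∈ dualCode C₂) (hb : b ∈ C₂ → b ∈ dualCode C₁) :
    Detects (cssCode C₁ C₂) (errorOp a b) := by
  by_cases haC : a ∈ C₁
  · have haW := ha haC
    have hshift : ∀ ψ ∈ cssCode C₁ C₂, ∀ y, ψ (y - a) = ψ y := by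
      intro ψ hψ y
      have := ((mem_cssCode_iff h ψ).mp hψ).1 (y - a) a haW
      rw [sub_add_cancel] at this
      exact this.symm
    by_cases hbC : b ∈ C₂
    · refine ⟨1, fun φ _ ψ hψ => ?_⟩
      rw [one_mul, inner_eq_sum, inner_eq_sum]
      refine Finset.sum_congr rfl fun y _ => ?_
      rw [errorOp_apply, hshift ψ hψ]
      by_cases hy : y ∈ C₁
      · rw [hb hbC _ (C₁.sub_mem hy haC), stdChar_zero, one_mul]
      · rw [((mem_cssCode_iff h ψ).mp hψ).2 y hy, mul_zero]
    · refine ⟨0, fun φ hφ ψ hψ => ?_⟩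
      obtain ⟨w, hw, hbw⟩ := exists_mem_dualCode_stdChar_ne_one hbC
      rw [zero_mul]
      -- Translating the summation variable by w changes neither state, only the phase.
      have key : stdChar F (b ⬝ᵥ w) * inner ℂ φ (errorOp a b ψ) = inner ℂ φ (errorOp a b ψ) := by
        rw [inner_eq_sum, Finset.mul_sum]
        refine Fintype.sum_equiv (Equiv.addRight w) _ _ fun y => ?_
        rw [Equiv.coe_addRight, errorOp_apply, errorOp_apply, hshift ψ hψ, hshift ψ hψ,
          ((mem_cssCode_iff h ψ).mp hψ).1 y w hw, ((mem_cssCode_iff h φ).mp hφ).1 y w hw,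
          add_sub_right_comm, dotProduct_add, stdChar_add]
        ring
      by_contra h0
      exact hbw (mul_right_cancel₀ h0 (by rw [key, one_mul]))
  · refine ⟨0, fun φ hφ ψ hψ => ?_⟩
    rw [zero_mul, inner_eq_sum]
    refine Finset.sum_eq_zero fun y _ => ?_
    by_cases hy : y ∈ C₁
    · have : y - a ∉ C₁ := fun hya => haC (by simpa using C₁.sub_mem hy hya)
      rw [errorOp_apply, ((mem_cssCode_iff h ψ).mp hψ).2 _ this, mul_zero, zero_mul]
    · rw [((mem_cssCode_iff h φ).mp hφ).2 y hy, map_zero, mul_zero]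

/-- X(a) carries |C₂^⊥⟩ to the orthogonal code state |a + C₂^⊥⟩. Testing against the first state
forces the detection scalar to be 0, testing against the second forbids it. -/
theorem not_detects_errorOp_zero_right {a : Fin n → F} (ha : a ∈ C₁)
    (ha' : a ∉ dualCode C₂) : ¬ Detects (cssCode C₁ C₂) (errorOp a 0) := by
  classical
  rintro ⟨c, hc⟩
  have hshift : errorOp a 0 (cosetState (dualCode C₂) 0) = cosetState (dualCode C₂) a := by
    ext y
    rw [errorOp_apply, zero_dotProduct, stdChar_zero, one_mul, cosetState_apply, cosetState_apply,
      sub_zero]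
  have h0 := cosetState_mem_cssCode (C₂ := C₂) C₁.zero_mem
  have h1 := hc _ h0 _ h0
  have h2 := hc _ (cosetState_mem_cssCode ha) _ h0
  rw [hshift] at h1 h2
  have horth : inner ℂ (cosetState (dualCode C₂) 0) (cosetState (dualCode C₂) a) = 0 := by
    rw [inner_eq_sum]
    refine Finset.sum_eq_zero fun y _ => ?_
    rw [cosetState_apply, cosetState_apply]
    by_cases hy : y - a ∈ dualCode C₂
    · rw [if_neg (c := y - 0 ∈ dualCode C₂), map_zero, mul_zero]
      intro hy'
      exact ha' (by simpa using Submodule.sub_mem _ hy' hy)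
    · rw [if_neg hy, zero_mul]
  have hne : inner ℂ (cosetState (dualCode C₂) a) (cosetState (dualCode C₂) a) ≠ 0 :=
    inner_self_ne_zero.mpr (cosetState_ne_zero _ _)
  have hne0 : inner ℂ (cosetState (dualCode C₂) 0) (cosetState (dualCode C₂) 0) ≠ 0 :=
    inner_self_ne_zero.mpr (cosetState_ne_zero _ _)
  rw [horth] at h1
  have hc0 : c = 0 := (mul_eq_zero.mp h1.symm).resolve_right hne0
  rw [hc0, zero_mul] at h2
  exact hne h2

/-- Since b ∈ C₂, each coset state is an eigenvector of Z(b) with eigenvalue χ(b · v). Detection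
would make this independent of v ∈ C₁, hence equal to its value 1 at v = 0. -/
theorem not_detects_errorOp_zero_left {b : Fin n → F} (hb : b ∈ C₂)
    (hb' : b ∉ dualCode C₁) : ¬ Detects (cssCode C₁ C₂) (errorOp 0 b) := by
  classical
  rintro ⟨c, hc⟩
  have hphase : ∀ v, errorOp 0 b (cosetState (dualCode C₂) v) =
      stdChar F (b ⬝ᵥ v) • cosetState (dualCode C₂) v := by
    intro v
    ext y
    rw [errorOp_apply, sub_zero, PiLp.smul_apply, smul_eq_mul, cosetState_apply]
    split_ifs with hy
    · have := dotProduct_eq_zero_of_mem_dualCode hb hy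
      rw [dotProduct_sub, sub_eq_zero] at this
      rw [this]
    · rw [mul_zero, mul_zero]
  have hcv : ∀ v ∈ C₁, stdChar F (b ⬝ᵥ v) = c := by
    intro v hv
    have h1 := hc _ (cosetState_mem_cssCode hv) _ (cosetState_mem_cssCode hv)
    rw [hphase, inner_smul_right] at h1
    exact mul_right_cancel₀ (inner_self_ne_zero.mpr (cosetState_ne_zero _ _)) h1
  obtain ⟨v, hv, hbv⟩ := exists_mem_dualCode_stdChar_ne_one hb'
  rw [dualCode_dualCode] at hv
  apply hbv
  rw [hcv v hv, ← hcv 0 C₁.zero_mem, dotProduct_zero, stdChar_zero]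

/-- The parameters and the exact distances of the CSS code of a pair `C₁^⊥ ⊆ C₂`. -/
theorem isAQC_and_distancesSharp_cssCode [DecidableEq F] (h : dualCode C₂ ≤ C₁) {k dz dx : ℕ}
    (hk : Module.finrank F C₁ - Module.finrank F (dualCode C₂) = k)
    (hdz : IsRelMinWeight C₂ (dualCode C₁) dz) (hdx : IsRelMinWeight C₁ (dualCode C₂) dx) :
    IsAQC (cssCode C₁ C₂) k dz dx ∧ DistancesSharp (cssCode C₁ C₂) dz dx := by
  have hpos : ∀ {C D : Submodule F (Fin n → F)} {d : ℕ}, IsRelMinWeight C D d → 1 ≤ d := by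
    rintro C D d ⟨⟨u, -, hu, rfl⟩, -⟩
    rw [Nat.one_le_iff_ne_zero, Ne, hammingNorm_eq_zero]
    rintro rfl
    exact hu D.zero_mem
  refine ⟨⟨isStabilizerCode_cssCode h, ?_, hpos hdz, hpos hdx, fun a b ha hb => ?_⟩, ?_, ?_⟩
  · rw [finrank_cssCode h, hk]
  · refine detects_cssCode h (fun haC => ?_) (fun hbC => ?_)
    · by_contra haW
      exact absurd (hdx.2 ⟨a, haC, haW, rfl⟩) (not_le.mpr ha)
    · by_contra hbD
      exact absurd (hdz.2 ⟨b, hbC, hbD, rfl⟩) (not_le.mpr hb)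
  · obtain ⟨a, ha, ha', hw⟩ := hdx.1
    exact ⟨a, hw, not_detects_errorOp_zero_right ha ha'⟩
  · obtain ⟨b, hb, hb', hw⟩ := hdz.1
    exact ⟨b, hw, not_detects_errorOp_zero_left hb hb'⟩

end CSS

/-! ### The quadratic extension -/

section Quadratic

variable {F K : Type*} [Field F] [Fintype F] [Field K] [Algebra F K] {q : ℕ}

theorem finite_of_finrank_eq_two (hK : Module.finrank F K = 2) : Finite K :=
  have : Module.Finite F K := Module.finite_of_finrank_pos (by omega)
  Module.finite_of_finite F

theorem natCard_quadratic (hq : Fintype.card F = q) (hK : Module.finrank F K = 2) :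
    Nat.card K = q ^ 2 := by
  have := finite_of_finrank_eq_two hK
  have : Module.Finite F K := Module.finite_of_finrank_pos (by omega)
  rw [Module.natCard_eq_pow_finrank (K := F), hK, Nat.card_eq_fintype_card, hq]

theorem pow_card_pow_card (hq : Fintype.card F = q) (hK : Module.finrank F K = 2) (z : K) :
    (z ^ q) ^ q = z := by
  have := finite_of_finrank_eq_two hK
  have := Fintype.ofFinite K
  rw [← pow_mul, ← sq, ← natCard_quadratic hq hK, Nat.card_eq_fintype_card, FiniteField.pow_card]

theorem algebraMap_pow_card (hq : Fintype.card F = q) (a : F) :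
    algebraMap F K a ^ q = algebraMap F K a := by
  rw [← map_pow, ← hq, FiniteField.pow_card]

/-- The q elements of F already exhaust the roots of X^q - X in K. -/
theorem mem_range_algebraMap_of_pow_card_eq (hq : Fintype.card F = q) {y : K} (hy : y ^ q = y) :
    y ∈ Set.range (algebraMap F K) := by
  classical
  have h1 : (X ^ q - X : K[X]) ≠ 0 :=
    FiniteField.X_pow_card_sub_X_ne_zero K (hq ▸ Fintype.one_lt_card)
  have h2 : (Finset.univ.image (algebraMap F K)) ⊆ (X ^ q - X : K[X]).roots.toFinset := by
    intro x hx
    obtain ⟨a, -, rfl⟩ := Finset.mem_image.mp hx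
    rw [Multiset.mem_toFinset, mem_roots h1]
    simp [algebraMap_pow_card hq]
  have h3 : (X ^ q - X : K[X]).roots.toFinset.card ≤ (Finset.univ.image (algebraMap F K)).card := by
    rw [Finset.card_image_of_injective _ (algebraMap F K).injective, Finset.card_univ, hq]
    refine (Multiset.toFinset_card_le _).trans ((card_roots' _).trans_eq ?_)
    exact FiniteField.X_pow_card_sub_X_natDegree_eq K (hq ▸ Fintype.one_lt_card)
  have h4 : y ∈ (X ^ q - X : K[X]).roots.toFinset := by
    rw [Multiset.mem_toFinset, mem_roots h1]
    simp [hy]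
  rw [← Finset.eq_of_subset_of_card_le h2 h3] at h4
  obtain ⟨a, -, ha⟩ := Finset.mem_image.mp h4
  exact ⟨a, ha⟩

theorem aeval_pow_card (hq : Fintype.card F = q) (f : F[X]) (x : K) :
    aeval (x ^ q) f = aeval x f ^ q := by
  subst hq
  exact aeval_algHom_apply (FiniteField.frobeniusAlgHom F K) x f

theorem two_mul_half_sq_sub (q : ℕ) : 2 * ((q ^ 2 - q) / 2) = q ^ 2 - q := by
  apply Nat.two_mul_div_two_of_even
  rw [sq, ← Nat.mul_sub_one]
  exact Nat.even_mul_pred_self q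

theorem exists_isXLListing (hq : Fintype.card F = q) (hK : Module.finrank F K = 2) :
    ∃ (α : Fin q → F) (β : Fin ((q ^ 2 - q) / 2) → K), IsXLListing α β := by
  classical
  have := finite_of_finrank_eq_two hK
  have := Fintype.ofFinite K
  let e := Fintype.equivFin K
  -- An arbitrary enumeration of K selects one element from each pair {x, x^q} with x ≠ x^q.
  let T := {x : K // e x < e (x ^ q)}
  let G : F ⊕ (T ⊕ T) → K :=
    Sum.elim (algebraMap F K) (Sum.elim (fun x => x.1) fun x => x.1 ^ q)
  have hqq := pow_card_pow_card (K := K) hq hK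
  have hT : ∀ (x : T) (a : F), algebraMap F K a ≠ x.1 := by
    intro x a h
    have := x.2
    rw [← h, algebraMap_pow_card hq] at this
    exact lt_irrefl _ this
  have hT' : ∀ (x : T) (a : F), algebraMap F K a ≠ x.1 ^ q := by
    intro x a h
    apply hT x a
    rw [← hqq x.1, ← h, algebraMap_pow_card hq]
  have hG : Function.Bijective G := by
    constructor
    · refine (algebraMap F K).injective.sumElim (Function.Injective.sumElim
        Subtype.val_injective (fun x y hxy => ?_) fun x y hxy => ?_) ?_
      · apply Subtype.ext
        rw [← hqq x.1, ← hqq y.1]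
        exact congrArg (· ^ q) hxy
      · have hx := x.2
        have hy := y.2
        rw [hxy, hqq] at hx
        exact lt_asymm hx hy
      · rintro a (x | x)
        · exact hT x a
        · exact hT' x a
    · intro x
      rcases lt_trichotomy (e x) (e (x ^ q)) with h | h | h
      · exact ⟨Sum.inr (Sum.inl ⟨x, h⟩), rfl⟩
      · obtain ⟨a, ha⟩ := mem_range_algebraMap_of_pow_card_eq hq (e.injective h).symm
        exact ⟨Sum.inl a, ha⟩
      · exact ⟨Sum.inr (Sum.inr ⟨x ^ q, by rwa [hqq]⟩), hqq x⟩
  have hcard : Fintype.card T = (q ^ 2 - q) / 2 := by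
    have h1 := Fintype.card_of_bijective hG
    have h2 := natCard_quadratic hq hK
    rw [Nat.card_eq_fintype_card] at h2
    rw [Fintype.card_sum, Fintype.card_sum, hq] at h1
    omega
  let eα : Fin q ≃ F := (Fintype.equivFinOfCardEq hq).symm
  let eβ : Fin ((q ^ 2 - q) / 2) ≃ T := (Fintype.equivFinOfCardEq hcard).symm
  refine ⟨eα, fun j => (eβ j).1, eα.bijective, ?_⟩
  convert hG.comp (Equiv.sumCongr eα (Equiv.sumCongr eβ eβ)).bijective using 1
  ext (i | j | j) <;> rfl

end Quadratic

/-! ### The spaces `V_{m,ℓ}` -/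

section Space

variable {F : Type*} [Field F] {q m l : ℕ}

theorem xlPoly_mem_xlSpace {i j : ℕ} (h : (i ≤ j ∧ j + 2 ≤ m) ∨ (i ≤ l ∧ j + 1 = m)) :
    xlPoly F q i j ∈ xlSpace F q m l :=
  Submodule.subset_span ⟨i, j, rfl, h⟩

theorem xlSpace_mono (hm : 3 ≤ m) : xlSpace F q 2 1 ≤ xlSpace F q m l := by
  refine Submodule.span_le.mpr ?_
  rintro _ ⟨i, j, rfl, h⟩
  exact xlPoly_mem_xlSpace (Or.inl (by omega))

/-- The pairs `(j, i)` such that `e_{i,j}` is in the defining basis of `V_{m,ℓ}`. -/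
def xlIndex (m l : ℕ) : Finset (Σ _ : ℕ, ℕ) :=
  (Finset.range m).sigma fun j => Finset.range (if j + 1 = m then l + 1 else j + 1)

theorem mem_xlIndex {p : Σ _ : ℕ, ℕ} :
    p ∈ xlIndex m l ↔ (p.2 ≤ p.1 ∧ p.1 + 2 ≤ m) ∨ (p.2 ≤ l ∧ p.1 + 1 = m) := by
  rw [xlIndex, Finset.mem_sigma, Finset.mem_range, Finset.mem_range]
  split_ifs <;> omega

theorem card_xlIndex (hm : 1 ≤ m) : (xlIndex m l).card = m * (m - 1) / 2 + l + 1 := by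
  obtain ⟨k, rfl⟩ := Nat.exists_eq_add_of_le' hm
  rw [xlIndex, Finset.card_sigma]
  simp only [Finset.card_range]
  -- The top value j = m - 1 contributes ℓ + 1; the smaller ones contribute 1 + 2 + ⋯ + (m - 1).
  rw [Finset.sum_range_succ, if_pos rfl, Finset.sum_congr rfl (g := fun j => j + 1), ← add_assoc,
    ← Finset.sum_range_id_mul_two, Nat.mul_div_cancel _ two_pos, Finset.sum_range_succ']
  · simp
  · intro j hj
    rw [Finset.mem_range] at hj
    rw [if_neg (by omega)]

theorem xlSpace_eq_span_range :
    xlSpace F q m l = Submodule.span F (Set.range fun p : xlIndex m l => xlPoly F q p.1.2 p.1.1) := by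
  unfold xlSpace
  congr 1
  ext f
  constructor
  · rintro ⟨i, j, rfl, h⟩
    exact ⟨⟨⟨j, i⟩, mem_xlIndex.mpr h⟩, rfl⟩
  · rintro ⟨⟨p, hp⟩, rfl⟩
    exact ⟨p.2, p.1, rfl, mem_xlIndex.mp hp⟩

theorem mul_add_eq_mul_add_iff {a b c d : ℕ} (hb : b < q) (hd : d < q) :
    a * q + b = c * q + d ↔ a = c ∧ b = d := by
  constructor
  · intro h
    have h1 := congrArg (· % q) h
    simp only [Nat.mul_add_mod', Nat.mod_eq_of_lt hb, Nat.mod_eq_of_lt hd] at h1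
    subst h1
    exact ⟨Nat.eq_of_mul_eq_mul_right (by omega) (Nat.add_right_cancel h), rfl⟩
  · rintro ⟨rfl, rfl⟩
    rfl

/-- Exponents below q² have unique base-q digits, so the exponent jq + i with i ≤ j occurs in
`xlPoly F q i j` alone. This coefficient serves as a dual functional in the independence proof. -/
theorem coeff_xlPoly {i j i' j' : ℕ} (hij : i ≤ j) (hj : j < q) (hij' : i' ≤ j') (hj' : j' < q) :
    (xlPoly F q i' j').coeff (j * q + i) = if i' = i ∧ j' = j then 1 else 0 := by
  unfold xlPoly
  split_ifs with h1 h2 h2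
  · obtain ⟨rfl, rfl⟩ := h2
    rw [h1, coeff_X_pow_self]
  · rw [coeff_X_pow, if_neg]
    rw [mul_add_eq_mul_add_iff (by omega) (by omega)]
    omega
  · obtain ⟨rfl, rfl⟩ := h2
    rw [coeff_add, coeff_X_pow_self, coeff_X_pow, if_neg, zero_add]
    rw [mul_add_eq_mul_add_iff (by omega) (by omega)]
    omega
  · rw [coeff_add, coeff_X_pow, coeff_X_pow, if_neg, if_neg, zero_add] <;>
    · rw [mul_add_eq_mul_add_iff (by omega) (by omega)]
      omega

theorem linearIndependent_xlPoly (hmq : m ≤ q) (hl : l + 1 ≤ m) :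
    LinearIndependent F fun p : xlIndex m l => xlPoly F q p.1.2 p.1.1 := by
  rw [Fintype.linearIndependent_iff]
  intro g hg p
  have hp : ∀ p : xlIndex m l, p.1.2 ≤ p.1.1 ∧ p.1.1 < q := by
    intro p
    have := mem_xlIndex.mp p.2
    omega
  have h := congrArg (fun f : F[X] => f.coeff (p.1.1 * q + p.1.2)) hg
  simp only [finsetSum_coeff, coeff_smul, coeff_zero] at h
  rw [Finset.sum_eq_single p] at h
  · rwa [coeff_xlPoly (hp p).1 (hp p).2 (hp p).1 (hp p).2, if_pos ⟨rfl, rfl⟩, smul_eq_mul,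
      mul_one] at h
  · intro p' _ hne
    rw [coeff_xlPoly (hp p).1 (hp p).2 (hp p').1 (hp p').2, if_neg, smul_zero]
    rintro ⟨h1, h2⟩
    exact hne (Subtype.ext (Sigma.ext h2 (heq_of_eq h1)))
  · intro h
    exact absurd (Finset.mem_univ p) h

theorem finrank_xlSpace (hmq : m ≤ q) (hl : l + 1 ≤ m) :
    Module.finrank F (xlSpace F q m l) = m * (m - 1) / 2 + l + 1 := by
  rw [xlSpace_eq_span_range, finrank_span_eq_card (linearIndependent_xlPoly hmq hl),
    Fintype.card_coe, card_xlIndex (by omega)]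

theorem natDegree_le_of_mem_xlSpace (hmq : m ≤ q) (hl : l + 1 ≤ m) {f : F[X]}
    (hf : f ∈ xlSpace F q m l) : f.natDegree ≤ q * (m - 1) + l := by
  rw [natDegree_le_iff_degree_le, ← mem_degreeLE]
  revert f
  change xlSpace F q m l ≤ _
  refine Submodule.span_le.mpr ?_
  rintro _ ⟨i, j, rfl, h⟩
  have h12 : i * q + j ≤ q * (m - 1) + l ∧ j * q + i ≤ q * (m - 1) + l := by
    have hq : 1 ≤ q := by omega
    have hsw : ∀ i j : ℕ, i ≤ j → i * q + j ≤ j * q + i := by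
      intro i j hij
      obtain ⟨d, rfl⟩ := Nat.exists_eq_add_of_le hij
      have : d * 1 ≤ d * q := Nat.mul_le_mul_left d hq
      linarith [add_mul i d q]
    have h2 : j * q + i ≤ q * (m - 1) + l := by
      rcases h with ⟨hij, hjm⟩ | ⟨hil, rfl⟩
      · have : (j + 1) * q ≤ (m - 1) * q := Nat.mul_le_mul_right q (by omega)
        linarith [add_mul j 1 q, mul_comm (m - 1) q]
      · rw [Nat.add_sub_cancel, mul_comm]
        omega
    exact ⟨(hsw i j (by omega)).trans h2, h2⟩
  rw [SetLike.mem_coe, mem_degreeLE, ← natDegree_le_iff_degree_le]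
  unfold xlPoly
  split_ifs
  · exact (natDegree_X_pow_le _).trans h12.1
  · exact natDegree_add_le_of_degree_le ((natDegree_X_pow_le _).trans h12.1)
      ((natDegree_X_pow_le _).trans h12.2)

variable [Fintype F]

theorem eval_X_pow_mul_card_add (hq : Fintype.card F = q) (a : F) (i j : ℕ) :
    eval a (X ^ (i * q + j) : F[X]) = a ^ (i + j) := by
  rw [eval_pow, eval_X, pow_add, pow_mul, ← hq, FiniteField.pow_card, ← pow_add]

/-- The factor iq + j reduces to j because q = 0 in F. The truncated exponent is harmless when i = j
= 0, where this factor vanishes. -/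
theorem eval_derivative_X_pow_mul_card_add (hq : Fintype.card F = q) (a : F) (i j : ℕ) :
    eval a (derivative (X ^ (i * q + j) : F[X])) = j * a ^ (i + j - 1) := by
  have hq0 : (q : F) = 0 := by rw [← hq]; exact FiniteField.cast_card_eq_zero F
  rw [derivative_X_pow, eval_mul, eval_C]
  push_cast
  rw [hq0, mul_zero, zero_add]
  rcases j with _ | j
  · simp
  · rw [← add_assoc, ← add_assoc, Nat.add_sub_cancel, Nat.add_sub_cancel,
      eval_X_pow_mul_card_add hq]

/-- On `F_q`, a polynomial of `V_{m,ℓ}` agrees with a polynomial of small degree, and the same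
holds for twice its derivative. -/
theorem exists_eval_eq_eval_of_mem_xlSpace (hq : Fintype.card F = q) (hl : l + 1 ≤ m) {f : F[X]}
    (hf : f ∈ xlSpace F q m l) :
    ∃ g : F[X], g.natDegree ≤ max (2 * (m - 2)) (m + l - 1) ∧
      ∀ a : F, eval a f = eval a g ∧ 2 * eval a (derivative f) = eval a (derivative g) := by
  induction hf using Submodule.span_induction with
  | mem f hf =>
    obtain ⟨i, j, rfl, h⟩ := hf
    by_cases hij : i = j
    · subst hij
      -- The derivative of X^(iq+i) at a is i·a^(2i-1), half that of X^(2i); this is the source of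
      -- the factor 2.
      refine ⟨X ^ (i + i), (natDegree_X_pow_le _).trans (by rw [le_max_iff]; omega), fun a => ?_⟩
      rw [xlPoly, if_pos rfl]
      refine ⟨by rw [eval_X_pow_mul_card_add hq, eval_pow, eval_X], ?_⟩
      rw [eval_derivative_X_pow_mul_card_add hq, derivative_X_pow, eval_mul, eval_C, eval_pow,
        eval_X]
      push_cast
      ring
    · refine ⟨C 2 * X ^ (i + j),
        (natDegree_C_mul_X_pow_le _ _).trans (by rw [le_max_iff]; omega), fun a => ?_⟩
      rw [xlPoly, if_neg hij]
      refine ⟨?_, ?_⟩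
      · rw [eval_add, eval_X_pow_mul_card_add hq, eval_X_pow_mul_card_add hq, eval_mul, eval_C,
          eval_pow, eval_X, add_comm j i]
        ring
      · rw [derivative_add, eval_add, eval_derivative_X_pow_mul_card_add hq,
          eval_derivative_X_pow_mul_card_add hq, derivative_C_mul_X_pow, eval_mul, eval_C,
          eval_pow, eval_X, add_comm j i]
        push_cast
        ring
  | zero => exact ⟨0, by simp, by simp⟩
  | add f₁ f₂ _ _ h₁ h₂ =>
    obtain ⟨g₁, hd₁, hg₁⟩ := h₁
    obtain ⟨g₂, hd₂, hg₂⟩ := h₂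
    refine ⟨g₁ + g₂, natDegree_add_le_of_degree_le hd₁ hd₂, fun a => ⟨?_, ?_⟩⟩
    · rw [eval_add, eval_add, (hg₁ a).1, (hg₂ a).1]
    · rw [derivative_add, derivative_add, eval_add, eval_add, mul_add, (hg₁ a).2, (hg₂ a).2]
  | smul c f _ h =>
    obtain ⟨g, hd, hg⟩ := h
    refine ⟨c • g, (natDegree_smul_le c g).trans hd, fun a => ⟨?_, ?_⟩⟩
    · rw [eval_smul, eval_smul, (hg a).1]
    · rw [derivative_smul, derivative_smul, eval_smul, eval_smul, ← (hg a).2, smul_eq_mul,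
        smul_eq_mul, mul_left_comm]

/-- In characteristic two, a polynomial of `V_{m,ℓ}` agrees on `F_q` with the square of a
polynomial of small degree. -/
theorem exists_eval_eq_sq_of_mem_xlSpace [CharP F 2] (hq : Fintype.card F = q) (hl : l + 1 ≤ m)
    {f : F[X]} (hf : f ∈ xlSpace F q m l) :
    ∃ h : F[X], h.natDegree ≤ (if l + 2 ≤ m then m - 2 else m - 1) ∧
      ∀ a : F, eval a f = eval a h ^ 2 := by
  induction hf using Submodule.span_induction with
  | mem f hf =>
    obtain ⟨i, j, rfl, h⟩ := hf
    by_cases hij : i = j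
    · subst hij
      refine ⟨X ^ i, (natDegree_X_pow_le _).trans (by split_ifs <;> omega), fun a => ?_⟩
      rw [xlPoly, if_pos rfl, eval_X_pow_mul_card_add hq, eval_pow, eval_X]
      ring
    -- Off-diagonal generators cancel on F_q, so only the e_{i,i} matter; i = m - 1 is among them
    -- only when ℓ = m - 1.
    · refine ⟨0, by simp, fun a => ?_⟩
      rw [xlPoly, if_neg hij, eval_add, eval_X_pow_mul_card_add hq, eval_X_pow_mul_card_add hq,
        add_comm j i, CharTwo.add_self_eq_zero]
      simp
  | zero => exact ⟨0, by simp, by simp⟩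
  | add f₁ f₂ _ _ h₁ h₂ =>
    obtain ⟨g₁, hd₁, hg₁⟩ := h₁
    obtain ⟨g₂, hd₂, hg₂⟩ := h₂
    refine ⟨g₁ + g₂, natDegree_add_le_of_degree_le hd₁ hd₂, fun a => ?_⟩
    rw [eval_add, eval_add, hg₁, hg₂, CharTwo.add_sq]
  | smul c f _ h =>
    obtain ⟨g, hd, hg⟩ := h
    -- Squaring is onto F in characteristic two, so scalars can be absorbed into the square.
    obtain ⟨b, rfl⟩ := FiniteField.isSquare_of_char_two (ringChar.eq F 2) c
    refine ⟨b • g, (natDegree_smul_le b g).trans hd, fun a => ?_⟩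
    rw [eval_smul, eval_smul, hg, smul_eq_mul, smul_eq_mul]
    ring

end Space

/-! ### Evaluation points and nesting of the codes -/

section Points

variable {F K : Type*} [Field F] [Field K] [Algebra F K] {q t m l : ℕ}
  {α : Fin q → F} {β : Fin ((q ^ 2 - q) / 2) → K}

theorem xlPoints_castAdd (ht : t ≤ q) (i : Fin t) :
    xlPoints ht α β (Fin.castAdd _ i) = algebraMap F K (α (Fin.castLE ht i)) :=
  Fin.append_left _ _ i

theorem xlPoints_natAdd (ht : t ≤ q) (j : Fin ((q ^ 2 - q) / 2)) :
    xlPoints ht α β (Fin.natAdd _ j) = β j :=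
  Fin.append_right _ _ j

theorem xlCode_mono (ht : t ≤ q) (hm : 3 ≤ m) : xlCode ht α β 2 1 ≤ xlCode ht α β m l :=
  fun _ ⟨f, hf, hc⟩ => ⟨f, xlSpace_mono hm hf, hc⟩

end Points

/-! ### The designed distance -/

section Distance

variable {F K : Type*} [Field F] [Fintype F] [Field K] [Algebra F K] {q t m l : ℕ}
  {α : Fin q → F} {β : Fin ((q ^ 2 - q) / 2) → K}

/-- Roots are counted over K along the listing. Frobenius fixes the coefficients of f, so each zero
β_j brings the distinct zero β_j^q. -/
theorem sum_rootMultiplicity_add_le [DecidableEq K] (hq : Fintype.card F = q)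
    (hK : Module.finrank F K = 2) (h : IsXLListing α β) {f : F[X]} (hf : f ≠ 0) :
    ∑ i, f.rootMultiplicity (α i) + 2 * (Finset.univ.filter fun j => aeval (β j) f = 0).card ≤
      f.natDegree := by
  have := finite_of_finrank_eq_two hK
  have := Fintype.ofFinite K
  have hp : f.map (algebraMap F K) ≠ 0 := map_ne_zero hf
  have hle : ∑ x : K, (f.map (algebraMap F K)).rootMultiplicity x ≤ f.natDegree := by
    simp only [← count_roots]
    rw [Multiset.sum_count_eq_card fun x _ => Finset.mem_univ x, ← natDegree_map (algebraMap F K)]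
    exact card_roots' _
  have hmult : ∀ x : K, aeval x f = 0 → 1 ≤ (f.map (algebraMap F K)).rootMultiplicity x := by
    intro x hx
    exact (rootMultiplicity_pos hp).mpr (by rwa [IsRoot, eval_map_algebraMap])
  have hsum : ∀ y : Fin ((q ^ 2 - q) / 2) → K, (∀ j, aeval (β j) f = 0 → aeval (y j) f = 0) →
      (Finset.univ.filter fun j => aeval (β j) f = 0).card ≤
        ∑ j, (f.map (algebraMap F K)).rootMultiplicity (y j) := by
    intro y hy
    rw [Finset.card_filter]
    refine Finset.sum_le_sum fun j _ => ?_
    split_ifs with hj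
    · exact hmult _ (hy j hj)
    · exact Nat.zero_le _
  have h1 := hsum β fun _ hj => hj
  have h2 := hsum (fun j => β j ^ q) fun j hj => by
    rw [aeval_pow_card hq, hj, zero_pow (by rw [← hq]; exact Fintype.card_ne_zero)]
  rw [← (Equiv.ofBijective _ h.bijective_all).sum_comp, Fintype.sum_sum_type,
    Fintype.sum_sum_type] at hle
  simp only [Equiv.ofBijective_apply, Sum.elim_inl, Sum.elim_inr] at hle
  simp only [← eq_rootMultiplicity_map (algebraMap F K).injective] at hle
  omega

/-- Otherwise f would have q² - q roots, while m ≤ q - 1 gives deg f ≤ q(q-2) + (q-2) < q² - q. -/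
theorem eq_zero_of_aeval_eq_zero (hq : Fintype.card F = q)
    (hK : Module.finrank F K = 2) (h : IsXLListing α β) (hmq : m + 1 ≤ q) (hl : l + 1 ≤ m)
    {f : F[X]} (hf : f ∈ xlSpace F q m l) (h0 : ∀ j, aeval (β j) f = 0) : f = 0 := by
  classical
  by_contra hne
  have h1 := sum_rootMultiplicity_add_le hq hK h hne
  have h2 := natDegree_le_of_mem_xlSpace (by omega) hl hf
  rw [Finset.filter_true_of_mem fun j _ => h0 j, Finset.card_univ, Fintype.card_fin,
    two_mul_half_sq_sub] at h1
  obtain ⟨c, rfl⟩ := Nat.exists_eq_add_of_le' hl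
  obtain ⟨d, rfl⟩ := Nat.exists_eq_add_of_le' hmq
  have h3 : (d + (c + (l + 1) + 1)) ^ 2 - (d + (c + (l + 1) + 1)) ≤
      (d + (c + (l + 1) + 1)) * (c + (l + 1) - 1) + l := by omega
  rw [Nat.sub_le_iff_le_add, ← add_assoc c l 1, Nat.add_sub_cancel] at h3
  nlinarith [Nat.zero_le (d * (d + c + l + 2)), Nat.zero_le c, Nat.zero_le d, Nat.zero_le l]

/-- Twice the number of zeros of a nonzero `f ∈ V_{m,ℓ}` among the evaluation points is at most
`q (m - 1) + ℓ + g`. -/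
theorem two_mul_card_zeros_le [DecidableEq F] [DecidableEq K] (hq : Fintype.card F = q)
    (hK : Module.finrank F K = 2) (h : IsXLListing α β) (ht : t ≤ q) (hmq : m ≤ q)
    (hl : l + 1 ≤ m) (hm : 2 ≤ m) {f : F[X]} (hf : f ∈ xlSpace F q m l) (hne : f ≠ 0) :
    2 * ((Finset.univ.filter fun i : Fin t => eval (α (Fin.castLE ht i)) f = 0).card +
      (Finset.univ.filter fun j => aeval (β j) f = 0).card : ℤ) ≤
      (q * (m - 1) + l : ℕ) + xlG q t m l := by
  -- With M the total multiplicity on F_q, this reads M + 2|B| ≤ q(m-1) + ℓ. It remains to bound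
  -- 2|A| - M by g.
  have hsum := (sum_rootMultiplicity_add_le hq hK h hne).trans
    (natDegree_le_of_mem_xlSpace hmq hl hf)
  set A := Finset.univ.filter fun i : Fin t => eval (α (Fin.castLE ht i)) f = 0 with hA
  set B := Finset.univ.filter fun j => aeval (β j) f = 0
  set M := ∑ i, f.rootMultiplicity (α i) with hM
  have hpos : ∀ a : F, eval a f = 0 → 1 ≤ f.rootMultiplicity a := fun a ha =>
    (rootMultiplicity_pos hne).mpr ha
  have hAt : A.card ≤ t := by
    simpa using Finset.card_filter_le Finset.univ fun i : Fin t => eval (α (Fin.castLE ht i)) f = 0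
  have hAM : A.card ≤ M := by
    rw [Finset.card_eq_sum_ones]
    calc ∑ i ∈ A, 1 ≤ ∑ i ∈ A, f.rootMultiplicity (α (Fin.castLE ht i)) :=
          Finset.sum_le_sum fun i hi => hpos _ (Finset.mem_filter.mp hi).2
      _ = ∑ i ∈ A.map (Fin.castLEEmb ht), f.rootMultiplicity (α i) := by
          rw [Finset.sum_map]
          rfl
      _ ≤ M := Finset.sum_le_sum_of_subset (Finset.subset_univ _)
  have hMq : ∀ k, (∀ a : F, k ≤ f.rootMultiplicity a) → q * k ≤ M := by
    intro k hk
    calc q * k = ∑ _i : Fin q, k := by simp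
      _ ≤ M := Finset.sum_le_sum fun i _ => hk _
  have hAg : ∀ g : F[X], g ≠ 0 → (∀ a, eval a f = 0 → eval a g = 0) → A.card ≤ g.natDegree := by
    intro g hg hfg
    have hinj : Function.Injective fun i : Fin t => α (Fin.castLE ht i) :=
      h.bijective_base.1.comp (Fin.castLE_injective ht)
    rw [← Finset.card_image_of_injective A hinj]
    refine le_trans (Finset.card_le_card ?_) ((Multiset.toFinset_card_le g.roots).trans
      (card_roots' g))
    intro a ha
    obtain ⟨i, hi, rfl⟩ := Finset.mem_image.mp ha
    rw [Multiset.mem_toFinset, mem_roots hg]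
    exact hfg _ (Finset.mem_filter.mp hi).2
  unfold xlG
  by_cases hodd : Odd q
  · rw [if_pos hodd]
    have h2 : (2 : F) ≠ 0 := by
      apply Ring.two_ne_zero
      intro hc
      rw [FiniteField.even_card_iff_char_two, hq] at hc
      exact (Nat.not_even_iff_odd.mpr hodd) (Nat.even_iff.mpr hc)
    obtain ⟨g, hd, hg⟩ := exists_eval_eq_eval_of_mem_xlSpace hq hl hf
    by_cases hg0 : g = 0
    -- Here f and, as 2 is invertible, its derivative vanish on all of F_q. Thus M ≥ 2q ≥ 2|A|, and
    -- g ≥ 0 suffices.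
    · have := hMq 2 fun a => by
        refine (one_lt_rootMultiplicity_iff_isRoot hne).mpr ⟨?_, ?_⟩
        · rw [IsRoot, (hg a).1, hg0, eval_zero]
        · have := (hg a).2
          rw [hg0, derivative_zero, eval_zero] at this
          exact (mul_eq_zero.mp this).resolve_left h2
      have h0 : (0 : ℤ) ≤ min (max (2 * ((m : ℤ) - 2)) ((m : ℤ) + l - 1)) t := by
        rw [le_min_iff, le_max_iff]
        omega
      omega
    -- A nonzero representative has at least |A| roots, which bounds |A| by g; with |A| ≤ M this
    -- gives 2|A| - M ≤ g.
    · have := hAg g hg0 fun a ha => (hg a).1 ▸ ha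
      have h0 : (A.card : ℤ) ≤ min (max (2 * ((m : ℤ) - 2)) ((m : ℤ) + l - 1)) t := by
        have := this.trans hd
        rw [le_max_iff] at this
        rw [le_min_iff, le_max_iff]
        omega
      omega
  · rw [if_neg hodd]
    have : CharP F 2 := by
      apply ringChar.of_eq
      rw [FiniteField.even_card_iff_char_two, hq]
      exact Nat.even_iff.mp (Nat.not_odd_iff_even.mp hodd)
    obtain ⟨g, hd, hg⟩ := exists_eval_eq_sq_of_mem_xlSpace hq hl hf
    by_cases hg0 : g = 0
    -- Now M ≥ q and |A| ≤ t, which is where the term 2t - q of g comes from.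
    · have := hMq 1 fun a => hpos a (by rw [hg, hg0]; simp)
      split_ifs
      · have := le_max_right (min ((m : ℤ) - 2) t) (2 * (t : ℤ) - q)
        omega
      · have := le_max_right (min ((m : ℤ) - 1) t) (2 * (t : ℤ) - q)
        omega
    · have := hAg g hg0 fun a ha => by
        rw [hg] at ha
        exact pow_eq_zero_iff two_ne_zero |>.mp ha
      split_ifs with hlm
      · rw [if_pos (by omega)] at hd
        have h0 : (A.card : ℤ) ≤ min ((m : ℤ) - 2) t := by
          rw [le_min_iff]
          omega
        have := h0.trans (le_max_left _ (2 * (t : ℤ) - q))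
        omega
      · rw [if_neg (by omega)] at hd
        have h0 : (A.card : ℤ) ≤ min ((m : ℤ) - 1) t := by
          rw [le_min_iff]
          omega
        have := h0.trans (le_max_left _ (2 * (t : ℤ) - q))
        omega

/-- A nonzero word of `C_q(t, m, ℓ)` has weight at least the designed distance. -/
theorem xlDelta_le_hammingNorm [DecidableEq F] (hq : Fintype.card F = q)
    (hK : Module.finrank F K = 2) (h : IsXLListing α β) (ht : t ≤ q) (hmq : m ≤ q)
    (hl : l + 1 ≤ m) (hm : 2 ≤ m) {c : Fin (t + (q ^ 2 - q) / 2) → F}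
    (hc : c ∈ xlCode ht α β m l) (hc0 : c ≠ 0) : xlDelta q t m l ≤ hammingNorm c := by
  classical
  obtain ⟨f, hf, hcf⟩ := hc
  have hne : f ≠ 0 := by
    rintro rfl
    apply hc0
    ext i
    have := hcf i
    rw [map_zero] at this
    exact (map_eq_zero _).mp this
  have hz : ∀ i, c i = 0 ↔ aeval (xlPoints ht α β i) f = 0 := fun i => by
    rw [← hcf, map_eq_zero]
  have hcard : (Finset.univ.filter fun i => c i = 0).card + hammingNorm c =
      t + (q ^ 2 - q) / 2 := by
    rw [hammingNorm, Finset.card_filter_add_card_filter_not, Finset.card_univ, Fintype.card_fin]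
  have hzeros : (Finset.univ.filter fun i => c i = 0).card =
      (Finset.univ.filter fun i : Fin t => eval (α (Fin.castLE ht i)) f = 0).card +
      (Finset.univ.filter fun j => aeval (β j) f = 0).card := by
    simp only [Finset.card_filter, hz]
    rw [Fin.sum_univ_add]
    simp only [xlPoints_castAdd, xlPoints_natAdd, aeval_algebraMap_apply, map_eq_zero,
      coe_aeval_eq_eval]
  have hmain := two_mul_card_zeros_le hq hK h ht hmq hl hm hf hne
  have hr : (2 : ℚ) * (((q ^ 2 - q) / 2 : ℕ) : ℚ) = (q : ℚ) ^ 2 - q := by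
    rw [← Nat.cast_ofNat, ← Nat.cast_mul, two_mul_half_sq_sub,
      Nat.cast_sub (Nat.le_self_pow two_ne_zero q), Nat.cast_pow]
  have hmain' := (Int.cast_le (R := ℚ)).mpr hmain
  have hcard' := congrArg (Nat.cast (R := ℚ)) (hzeros ▸ hcard)
  push_cast [Nat.cast_sub (show 1 ≤ m by omega)] at hmain' hcard'
  unfold xlDelta
  have hcast : (((q ^ 2 - q) / 2 : ℕ) : ℚ) = ((q : ℚ) ^ 2 - q) / 2 := by linarith
  linarith

/-- Evaluation at the β_j alone is injective on V_{m,ℓ}. The code and V_{m,ℓ} have the same image in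
K^n. -/
theorem finrank_xlCode (hq : Fintype.card F = q) (hK : Module.finrank F K = 2)
    (h : IsXLListing α β) (ht : t ≤ q) (hmq : m + 1 ≤ q) (hl : l + 1 ≤ m) :
    Module.finrank F (xlCode ht α β m l) = m * (m - 1) / 2 + l + 1 := by
  rw [← finrank_xlSpace (F := F) (q := q) (by omega) hl]
  let ι : (Fin (t + (q ^ 2 - q) / 2) → F) →ₗ[F] (Fin (t + (q ^ 2 - q) / 2) → K) :=
    (Algebra.linearMap F K).compLeft _
  have hι : Function.Injective ι := fun u v huv => by
    ext i
    exact (algebraMap F K).injective (congrFun huv i)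
  let ev : F[X] →ₗ[F] (Fin (t + (q ^ 2 - q) / 2) → K) :=
    LinearMap.pi fun i => (aeval (xlPoints ht α β i)).toLinearMap
  have hev : Function.Injective (ev.domRestrict (xlSpace F q m l)) := by
    rw [← LinearMap.ker_eq_bot, LinearMap.ker_eq_bot']
    rintro ⟨f, hf⟩ h0
    apply Subtype.ext
    refine eq_zero_of_aeval_eq_zero hq hK h hmq hl hf fun j => ?_
    rw [← xlPoints_natAdd (α := α) (β := β) ht j]
    exact congrFun h0 _
  have hmap : (xlCode ht α β m l).map ι = (xlSpace F q m l).map ev := by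
    ext c
    constructor
    · rintro ⟨u, ⟨f, hf, hu⟩, rfl⟩
      exact ⟨f, hf, funext fun i => (hu i).symm⟩
    · rintro ⟨f, hf, rfl⟩
      choose u hu using fun i => aeval_mem_range_of_mem_xlSpace hq hK hf (xlPoints ht α β i)
      exact ⟨u, ⟨f, hf, hu⟩, funext hu⟩
  rw [← LinearMap.finrank_range_of_inj hev,
    (Submodule.equivMapOfInjective ι hι (xlCode ht α β m l)).finrank_eq, LinearMap.range_domRestrict, hmap]

end Distance

/-! ### The dual of `C_q(t, 2, 1)` -/

section TraceNorm

variable {F K : Type*} [Field F] [Field K] [Algebra F K] {q t m l : ℕ}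
  {α : Fin q → F} {β : Fin ((q ^ 2 - q) / 2) → K}

/-- `τ` and `ν` list the traces and the norms of the evaluation points over `F_q`. -/
structure IsTraceNorm (ht : t ≤ q) (α : Fin q → F) (β : Fin ((q ^ 2 - q) / 2) → K)
    (τ ν : Fin (t + (q ^ 2 - q) / 2) → F) : Prop where
  trace : ∀ i, algebraMap F K (τ i) = xlPoints ht α β i + xlPoints ht α β i ^ q
  norm : ∀ i, algebraMap F K (ν i) = xlPoints ht α β i * xlPoints ht α β i ^ q

/-- Words of `C_q(t, m, ℓ)^⊥` are orthogonal to the values of `e_{0,2}`. -/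
theorem IsTraceNorm.dotProduct_eq_zero {ht : t ≤ q}
    {τ ν : Fin (t + (q ^ 2 - q) / 2) → F} (hτν : IsTraceNorm ht α β τ ν) (hm : 3 ≤ m)
    {u : Fin (t + (q ^ 2 - q) / 2) → F}
    (hu : u ∈ dualCode (xlCode ht α β m l)) : u ⬝ᵥ (fun i => τ i ^ 2 - 2 * ν i) = 0 := by
  refine hu _ ⟨xlPoly F q 0 2, xlPoly_mem_xlSpace (by omega), fun i => ?_⟩
  rw [map_sub, map_mul, map_pow, hτν.trace, hτν.norm, xlPoly, if_neg (by omega)]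
  simp only [map_ofNat, map_add, map_pow, aeval_X, zero_mul, zero_add, add_zero]
  rw [mul_comm 2 q, pow_mul]
  ring

end TraceNorm

section DualXL

variable {F K : Type*} [Field F] [Fintype F] [Field K] [Algebra F K] {q t m l : ℕ}
  {α : Fin q → F} {β : Fin ((q ^ 2 - q) / 2) → K}

theorem mem_dualCode_xlCode_iff (hq : Fintype.card F = q) (hK : Module.finrank F K = 2)
    (ht : t ≤ q) {u : Fin (t + (q ^ 2 - q) / 2) → F} :
    u ∈ dualCode (xlCode ht α β m l) ↔
      ∀ f ∈ xlSpace F q m l, ∑ i, algebraMap F K (u i) * aeval (xlPoints ht α β i) f = 0 := by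
  constructor
  · intro hu f hf
    choose c hc using fun i => aeval_mem_range_of_mem_xlSpace hq hK hf (xlPoints ht α β i)
    have := congrArg (algebraMap F K) (hu c ⟨f, hf, hc⟩)
    rw [dotProduct, map_sum, map_zero] at this
    simpa only [map_mul, hc] using this
  · rintro hu c ⟨f, hf, hc⟩
    apply (algebraMap F K).injective
    rw [dotProduct, map_sum, map_zero]
    simpa only [map_mul, hc] using hu f hf

theorem exists_isTraceNorm (hq : Fintype.card F = q) (hK : Module.finrank F K = 2) (ht : t ≤ q)
    (α : Fin q → F) (β : Fin ((q ^ 2 - q) / 2) → K) :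
    ∃ τ ν, IsTraceNorm ht α β τ ν := by
  have h1 : xlPoly F q 0 1 ∈ xlSpace F q 2 1 := xlPoly_mem_xlSpace (by omega)
  have h2 : xlPoly F q 1 1 ∈ xlSpace F q 2 1 := xlPoly_mem_xlSpace (by omega)
  choose τ hτ using fun i => aeval_mem_range_of_mem_xlSpace hq hK h1 (xlPoints ht α β i)
  choose ν hν using fun i => aeval_mem_range_of_mem_xlSpace hq hK h2 (xlPoints ht α β i)
  refine ⟨τ, ν, fun i => ?_, fun i => ?_⟩
  · rw [hτ, xlPoly, if_neg zero_ne_one]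
    simp
  · rw [hν, xlPoly, if_pos rfl]
    simp [pow_succ']

variable {ht : t ≤ q} {τ ν : Fin (t + (q ^ 2 - q) / 2) → F}

/-- V_{2,1} is spanned by e_{0,0}, e_{0,1}, e_{1,1}, whose values are 1, the trace and the norm. -/
theorem IsTraceNorm.mem_dualCode_iff (hτν : IsTraceNorm ht α β τ ν) (hq : Fintype.card F = q)
    (hK : Module.finrank F K = 2) {u : Fin (t + (q ^ 2 - q) / 2) → F} :
    u ∈ dualCode (xlCode ht α β 2 1) ↔ u ⬝ᵥ 1 = 0 ∧ u ⬝ᵥ τ = 0 ∧ u ⬝ᵥ ν = 0 := by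
  rw [mem_dualCode_xlCode_iff hq hK]
  have hdot : ∀ (v : Fin (t + (q ^ 2 - q) / 2) → F) (f : F[X]),
      (∀ i, algebraMap F K (v i) = aeval (xlPoints ht α β i) f) →
      (∑ i, algebraMap F K (u i) * aeval (xlPoints ht α β i) f = 0 ↔ u ⬝ᵥ v = 0) := by
    intro v f hv
    simp only [← hv, ← map_mul, ← map_sum, map_eq_zero]
    rfl
  have h1 := hdot 1 (xlPoly F q 0 0) fun i => by simp [xlPoly]
  have h2 := hdot τ (xlPoly F q 0 1) fun i => by simp [xlPoly, hτν.trace]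
  have h3 := hdot ν (xlPoly F q 1 1) fun i => by simp [xlPoly, hτν.norm, pow_succ']
  constructor
  · intro hu
    exact ⟨h1.mp (hu _ (xlPoly_mem_xlSpace (by omega))),
      h2.mp (hu _ (xlPoly_mem_xlSpace (by omega))), h3.mp (hu _ (xlPoly_mem_xlSpace (by omega)))⟩
  · rintro ⟨hu1, hu2, hu3⟩ f hf
    induction hf using Submodule.span_induction with
    | mem f hf =>
      obtain ⟨i, j, rfl, hij⟩ := hf
      obtain ⟨rfl, rfl⟩ | ⟨rfl, rfl⟩ | ⟨rfl, rfl⟩ :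
          (i = 0 ∧ j = 0) ∨ (i = 0 ∧ j = 1) ∨ (i = 1 ∧ j = 1) := by omega
      · exact h1.mpr hu1
      · exact h2.mpr hu2
      · exact h3.mpr hu3
    | zero => simp
    | add f g _ _ hf hg => simp [mul_add, Finset.sum_add_distrib, hf, hg]
    | smul c f _ hf =>
      simp only [map_smul, Algebra.mul_smul_comm, ← Finset.smul_sum, hf, smul_zero]

theorem eq_of_xlPoints_eq (hq : Fintype.card F = q) (h : IsXLListing α β) {i j : Fin (t + (q ^ 2 - q) / 2)}
    (hij : xlPoints ht α β i = xlPoints ht α β j ∨ xlPoints ht α β i = xlPoints ht α β j ^ q) :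
    i = j := by
  have hinj := h.bijective_all.1
  have hαα : ∀ a b, algebraMap F K (α a) = algebraMap F K (α b) → a = b := fun a b hab =>
    Sum.inl_injective (@hinj (Sum.inl a) (Sum.inl b) hab)
  have hαβ : ∀ a b, algebraMap F K (α a) ≠ β b := fun a b hab =>
    Sum.inl_ne_inr (@hinj (Sum.inl a) (Sum.inr (Sum.inl b)) hab)
  have hαβq : ∀ a b, algebraMap F K (α a) ≠ β b ^ q := fun a b hab =>
    Sum.inl_ne_inr (@hinj (Sum.inl a) (Sum.inr (Sum.inr b)) hab)
  have hββ : ∀ a b, β a = β b → a = b := fun a b hab =>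
    Sum.inl_injective (Sum.inr_injective
      (@hinj (Sum.inr (Sum.inl a)) (Sum.inr (Sum.inl b)) hab))
  have hββq : ∀ a b, β a ≠ β b ^ q := fun a b hab =>
    Sum.inl_ne_inr (Sum.inr_injective
      (@hinj (Sum.inr (Sum.inl a)) (Sum.inr (Sum.inr b)) hab))
  induction i using Fin.addCases with
  | left i =>
    induction j using Fin.addCases with
    | left j =>
      rw [xlPoints_castAdd, xlPoints_castAdd, algebraMap_pow_card hq, or_self] at hij
      rw [Fin.castLE_injective ht (hαα _ _ hij)]
    | right j =>
      rw [xlPoints_castAdd, xlPoints_natAdd] at hij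
      exact absurd hij (not_or.mpr ⟨hαβ _ _, hαβq _ _⟩)
  | right i =>
    induction j using Fin.addCases with
    | left j =>
      rw [xlPoints_castAdd, xlPoints_natAdd, algebraMap_pow_card hq, or_self] at hij
      exact absurd hij.symm (hαβ _ _)
    | right j =>
      rw [xlPoints_natAdd, xlPoints_natAdd] at hij
      rw [hββ i j (hij.resolve_right (hββq _ _))]

/-- Equal trace and norm make x_i a root of (X - x_j)(X - x_j^q), and the points represent distinct
conjugacy classes. -/
theorem IsTraceNorm.eq_of_eq (hτν : IsTraceNorm ht α β τ ν) (hq : Fintype.card F = q)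
    (h : IsXLListing α β) {i j : Fin (t + (q ^ 2 - q) / 2)}
    (h1 : τ i = τ j) (h2 : ν i = ν j) : i = j := by
  apply eq_of_xlPoints_eq (ht := ht) hq h
  have e1 := hτν.trace i
  have e2 := hτν.norm i
  rw [h1, hτν.trace j] at e1
  rw [h2, hτν.norm j] at e2
  rw [← sub_eq_zero, ← sub_eq_zero (b := xlPoints ht α β j ^ q), ← mul_eq_zero]
  linear_combination -xlPoints ht α β i * e1 + e2

/-- A nonzero word of `C_q(t, 2, 1)^⊥` has weight at least three. -/
theorem IsTraceNorm.three_le_hammingNorm [DecidableEq F] (hτν : IsTraceNorm ht α β τ ν)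
    (hq : Fintype.card F = q) (hK : Module.finrank F K = 2) (h : IsXLListing α β)
    {u : Fin (t + (q ^ 2 - q) / 2) → F} (hu : u ∈ dualCode (xlCode ht α β 2 1)) (hu0 : u ≠ 0) :
    3 ≤ hammingNorm u := by
  rw [hτν.mem_dualCode_iff hq hK] at hu
  by_contra! hlt
  have hs : ∀ v : Fin (t + (q ^ 2 - q) / 2) → F,
      u ⬝ᵥ v = ∑ i ∈ Finset.univ.filter fun i => u i ≠ 0, u i * v i := by
    intro v
    rw [dotProduct, Finset.sum_filter_of_ne]
    intro i _ hi
    exact left_ne_zero_of_mul hi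
  have hpos : hammingNorm u ≠ 0 := hammingNorm_ne_zero_iff.mpr hu0
  obtain h1 | h2 : hammingNorm u = 1 ∨ hammingNorm u = 2 := by omega
  · obtain ⟨i, hi⟩ := Finset.card_eq_one.mp h1
    have hui : i ∈ Finset.univ.filter fun i => u i ≠ 0 := hi ▸ Finset.mem_singleton_self i
    replace hui : u i ≠ 0 := (Finset.mem_filter.mp hui).2
    have := hu.1
    rw [hs, hi, Finset.sum_singleton, Pi.one_apply, mul_one] at this
    exact hui this
  · obtain ⟨i, j, hij, hi⟩ := Finset.card_eq_two.mp h2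
    have hui : i ∈ Finset.univ.filter fun i => u i ≠ 0 := hi ▸ Finset.mem_insert_self i {j}
    replace hui : u i ≠ 0 := (Finset.mem_filter.mp hui).2
    obtain ⟨e1, e2, e3⟩ := hu
    rw [hs, hi, Finset.sum_pair hij] at e1 e2 e3
    simp only [Pi.one_apply, mul_one] at e1
    -- Orthogonality to 1 gives u_j = -u_i, so the two points share trace and norm.
    have key : ∀ x y : F, u i * x + u j * y = 0 → x = y := by
      intro x y hxy
      rw [← sub_eq_zero]
      apply (mul_eq_zero.mp _).resolve_left hui
      linear_combination hxy - y * e1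
    exact hij (hτν.eq_of_eq hq h (key _ _ e2) (key _ _ e3))

/-- Three evaluation points whose traces and norms lie on a non-vertical line support a word of
`C_q(t, 2, 1)^⊥` outside `C_q(t, m, ℓ)^⊥`. -/
theorem IsTraceNorm.exists_hammingNorm_eq_three [DecidableEq F] (hτν : IsTraceNorm ht α β τ ν)
    (hq : Fintype.card F = q) (hK : Module.finrank F K = 2) (hm : 3 ≤ m)
    {i₁ i₂ i₃ : Fin (t + (q ^ 2 - q) / 2)} (h12 : τ i₁ ≠ τ i₂) (h13 : τ i₁ ≠ τ i₃)
    (h23 : τ i₂ ≠ τ i₃) {s w : F} (h1 : ν i₁ = s * τ i₁ + w) (h2 : ν i₂ = s * τ i₂ + w)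
    (h3 : ν i₃ = s * τ i₃ + w) :
    ∃ u ∈ dualCode (xlCode ht α β 2 1), u ∉ dualCode (xlCode ht α β m l) ∧ hammingNorm u = 3 := by
  have n12 : i₁ ≠ i₂ := fun e => h12 (congrArg τ e)
  have n13 : i₁ ≠ i₃ := fun e => h13 (congrArg τ e)
  have n23 : i₂ ≠ i₃ := fun e => h23 (congrArg τ e)
  -- The entries are the cross product of (1,1,1) with the three traces, up to sign; orthogonality
  -- to ν follows since ν is affine in τ there.
  set u : Fin (t + (q ^ 2 - q) / 2) → F := Pi.single i₁ (τ i₂ - τ i₃) +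
    Pi.single i₂ (τ i₃ - τ i₁) + Pi.single i₃ (τ i₁ - τ i₂) with hu
  have hdot : ∀ v : Fin (t + (q ^ 2 - q) / 2) → F, u ⬝ᵥ v =
      (τ i₂ - τ i₃) * v i₁ + (τ i₃ - τ i₁) * v i₂ + (τ i₁ - τ i₂) * v i₃ := by
    intro v
    rw [hu, add_dotProduct, add_dotProduct, single_dotProduct, single_dotProduct,
      single_dotProduct]
  refine ⟨u, (hτν.mem_dualCode_iff hq hK).mpr ⟨?_, ?_, ?_⟩, fun hmem => ?_, ?_⟩
  · rw [hdot]
    simp only [Pi.one_apply]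
    ring
  · rw [hdot]
    ring
  · rw [hdot, h1, h2, h3]
    ring
  · have := hτν.dotProduct_eq_zero hm hmem
    rw [hdot, h1, h2, h3] at this
    -- The norm part of τ² - 2ν drops out, leaving the Vandermonde determinant of the traces.
    have h0 : (τ i₁ - τ i₂) * (τ i₁ - τ i₃) * (τ i₂ - τ i₃) = 0 := by
      linear_combination this
    rcases mul_eq_zero.mp h0 with h0 | h0
    · rcases mul_eq_zero.mp h0 with h0 | h0
      · exact h12 (sub_eq_zero.mp h0)
      · exact h13 (sub_eq_zero.mp h0)
    · exact h23 (sub_eq_zero.mp h0)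
  · rw [hammingNorm, Finset.card_eq_three]
    refine ⟨i₁, i₂, i₃, n12, n13, n23, ?_⟩
    ext i
    simp only [Finset.mem_filter, Finset.mem_univ, true_and, Finset.mem_insert,
      Finset.mem_singleton, hu, Pi.add_apply]
    by_cases e1 : i = i₁
    · subst e1
      simp [n12, n13, sub_eq_zero, h23]
    · by_cases e2 : i = i₂
      · subst e2
        simp [e1, n23, sub_eq_zero, h13.symm]
      · by_cases e3 : i = i₃
        · subst e3
          simp [e1, e2, sub_eq_zero, h12]
        · simp [e1, e2, e3]

/-- For q ≥ 5 the q(q-1)/2 points β_j have only q - 1 possible norms, so three share one and lie on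
a horizontal line. For q = 4 this average is just 2. Instead, lines are drawn through the point (0,
a²) of a rational a, and two of the six β_j share one of the three available slopes. -/
theorem exists_weight_three [DecidableEq F] (hq : Fintype.card F = q)
    (hK : Module.finrank F K = 2) (h : IsXLListing α β) (hm : 3 ≤ m)
    (hqt : 5 ≤ q ∨ (q = 4 ∧ 1 ≤ t)) (hτν : IsTraceNorm ht α β τ ν) :
    ∃ u ∈ dualCode (xlCode ht α β 2 1), u ∉ dualCode (xlCode ht α β m l) ∧ hammingNorm u = 3 := by
  have hq0 : q ≠ 0 := by omega
  have hr := two_mul_half_sq_sub q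
  have hβα : ∀ (a : F) j, β j ≠ algebraMap F K a := by
    intro a j hj
    obtain ⟨i, rfl⟩ := h.bijective_base.2 a
    exact Sum.inr_ne_inl (@h.bijective_all.1 (Sum.inr (Sum.inl j)) (Sum.inl i) hj)
  have hββ : ∀ j, β j ^ q ≠ β j := by
    intro j hj
    exact Sum.inr_ne_inl (Sum.inr_injective
      (@h.bijective_all.1 (Sum.inr (Sum.inr j)) (Sum.inr (Sum.inl j)) hj))
  have hν : ∀ j, algebraMap F K (ν (Fin.natAdd t j)) = β j * β j ^ q := fun j => by
    rw [hτν.norm, xlPoints_natAdd]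
  have hτ : ∀ j, algebraMap F K (τ (Fin.natAdd t j)) = β j + β j ^ q := fun j => by
    rw [hτν.trace, xlPoints_natAdd]
  -- On a non-vertical line the trace determines the norm, hence the point.
  have hline : ∀ {s w : F} {j j' : Fin ((q ^ 2 - q) / 2)}, j ≠ j' →
      ν (Fin.natAdd t j) = s * τ (Fin.natAdd t j) + w →
      ν (Fin.natAdd t j') = s * τ (Fin.natAdd t j') + w →
      τ (Fin.natAdd t j) ≠ τ (Fin.natAdd t j') := by
    intro s w j j' hjj h1 h2 e
    exact hjj ((Fin.natAdd_injective _ t) (hτν.eq_of_eq hq h e (by rw [h1, h2, e])))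
  rcases hqt with h5 | ⟨h4, ht1⟩
  · have hmaps : ∀ j ∈ (Finset.univ : Finset (Fin ((q ^ 2 - q) / 2))),
        ν (Fin.natAdd t j) ∈ (Finset.univ.erase 0 : Finset F) := by
      intro j _
      rw [Finset.mem_erase]
      refine ⟨fun h0 => ?_, Finset.mem_univ _⟩
      have := hν j
      rw [h0, map_zero] at this
      have hj : β j = 0 := by
        rcases mul_eq_zero.mp this.symm with h | h
        · exact h
        · exact (pow_eq_zero_iff hq0).mp h
      exact hβα 0 j (by rw [hj, map_zero])
    obtain ⟨y, -, hy⟩ := Finset.exists_lt_card_fiber_of_mul_lt_card_of_maps_to hmaps (n := 2) (by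
      rw [Finset.card_erase_of_mem (Finset.mem_univ _), Finset.card_univ, Finset.card_univ, hq,
        Fintype.card_fin]
      obtain ⟨k, rfl⟩ := Nat.exists_eq_add_of_le' h5
      have : (k + 5) ^ 2 - (k + 5) = (k + 5) * (k + 4) := by
        rw [Nat.sub_eq_iff_eq_add (Nat.le_self_pow two_ne_zero _)]
        ring
      rw [this] at hr
      rw [this]
      have : k + 5 - 1 = k + 4 := rfl
      rw [this]
      nlinarith)
    obtain ⟨a, b, c, ha, hb, hc, hab, hac, hbc⟩ := Finset.two_lt_card_iff.mp hy
    have e : ∀ {j}, j ∈ Finset.univ.filter (fun j => ν (Fin.natAdd t j) = y) →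
        ν (Fin.natAdd t j) = 0 * τ (Fin.natAdd t j) + y := fun {j} hj => by
      rw [(Finset.mem_filter.mp hj).2, zero_mul, zero_add]
    exact hτν.exists_hammingNorm_eq_three hq hK hm (hline hab (e ha) (e hb))
      (hline hac (e ha) (e hc)) (hline hbc (e hb) (e hc)) (e ha) (e hb) (e hc)
  · have : CharP F 2 := by
      apply ringChar.of_eq
      rw [FiniteField.even_card_iff_char_two, hq, h4]
    have : CharP K 2 := charP_of_injective_algebraMap (algebraMap F K).injective 2
    set i₀ : Fin (t + (q ^ 2 - q) / 2) := Fin.castAdd _ ⟨0, ht1⟩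
    set a : F := α (Fin.castLE ht ⟨0, ht1⟩) with ha
    have hi₀ : xlPoints ht α β i₀ = algebraMap F K a := xlPoints_castAdd ht _
    have hτ₀ : τ i₀ = 0 := by
      apply (algebraMap F K).injective
      rw [hτν.trace, hi₀, algebraMap_pow_card hq, CharTwo.add_self_eq_zero, map_zero]
    have hν₀ : ν i₀ = a ^ 2 := by
      apply (algebraMap F K).injective
      rw [hτν.norm, hi₀, algebraMap_pow_card hq, map_pow, sq]
    have hτ0 : ∀ j, τ (Fin.natAdd t j) ≠ 0 := by
      intro j h0
      have := hτ j
      rw [h0, map_zero] at this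
      exact hββ j (CharTwo.add_eq_zero.mp this.symm).symm
    let s : Fin ((q ^ 2 - q) / 2) → F := fun j =>
      (ν (Fin.natAdd t j) - a ^ 2) / τ (Fin.natAdd t j)
    have hs : ∀ j, ν (Fin.natAdd t j) = s j * τ (Fin.natAdd t j) + a ^ 2 := by
      intro j
      rw [div_mul_cancel₀ _ (hτ0 j), sub_add_cancel]
    have hmaps : ∀ j ∈ (Finset.univ : Finset (Fin ((q ^ 2 - q) / 2))),
        s j ∈ (Finset.univ.erase a : Finset F) := by
      intro j _
      rw [Finset.mem_erase]
      refine ⟨fun h0 => ?_, Finset.mem_univ _⟩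
      have e := congrArg (algebraMap F K) (hs j)
      rw [h0, map_add, map_mul, map_pow, hν, hτ] at e
      -- Slope a is excluded: in characteristic two it would make the norm of β_j - a vanish.
      have e' : (β j - algebraMap F K a) * (β j ^ q - algebraMap F K a) = 0 := by
        have h2 : (2 : K) = 0 := CharTwo.two_eq_zero
        linear_combination e + algebraMap F K a ^ 2 * h2
      rcases mul_eq_zero.mp e' with e' | e'
      · exact hβα a j (sub_eq_zero.mp e')
      · apply hβα a j
        rw [← pow_card_pow_card hq hK (β j), sub_eq_zero.mp e', algebraMap_pow_card hq]
    obtain ⟨y, -, hy⟩ := Finset.exists_lt_card_fiber_of_mul_lt_card_of_maps_to hmaps (n := 1) (by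
      rw [Finset.card_erase_of_mem (Finset.mem_univ _), Finset.card_univ, Finset.card_univ, hq,
        Fintype.card_fin, h4]
      norm_num)
    obtain ⟨b, c, hb, hc, hbc⟩ := Finset.one_lt_card_iff.mp hy
    have e : ∀ {j}, j ∈ Finset.univ.filter (fun j => s j = y) →
        ν (Fin.natAdd t j) = y * τ (Fin.natAdd t j) + a ^ 2 := fun {j} hj => by
      rw [← (Finset.mem_filter.mp hj).2, hs]
    refine hτν.exists_hammingNorm_eq_three hq hK hm (i₁ := i₀) (s := y) (w := a ^ 2) ?_ ?_
      (hline hbc (e hb) (e hc)) ?_ (e hb) (e hc)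
    · rw [hτ₀]
      exact (hτ0 b).symm
    · rw [hτ₀]
      exact (hτ0 c).symm
    · rw [hτ₀, hν₀, mul_zero, zero_add]

end DualXL

/-! ### Assembly of the main theorem -/

theorem mainTheorem3 {F K : Type*} [Field F] [Fintype F] [DecidableEq F] [Field K] [Algebra F K]
    (q : ℕ) (hq : Fintype.card F = q) (hK : Module.finrank F K = 2)
    (t m l : ℕ) (ht : t ≤ q)
    (hparam : (q = 4 ∧ 1 ≤ t ∧ t ≤ 4 ∧ m = 3 ∧ l ≤ 2) ∨
      (5 ≤ q ∧ t ≤ q ∧ 3 ≤ m ∧ m ≤ q - 1 ∧ l ≤ m - 1)) :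
    (∃ (α : Fin q → F) (β : Fin ((q ^ 2 - q) / 2) → K), IsXLListing α β) ∧
    ∀ (α : Fin q → F) (β : Fin ((q ^ 2 - q) / 2) → K), IsXLListing α β →
      xlCode ht α β 2 1 < xlCode ht α β m l ∧
      ∃ dz : ℕ,
        xlDelta q t m l ≤ (dz : ℚ) ∧
        IsRelMinWeight (xlCode ht α β m l) (xlCode ht α β 2 1) dz ∧
        IsRelMinWeight (dualCode (xlCode ht α β 2 1)) (dualCode (xlCode ht α β m l)) 3 ∧
        IsAQC (cssCode (dualCode (xlCode ht α β 2 1)) (xlCode ht α β m l))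
          (m * (m - 1) / 2 + l - 2) dz 3 ∧
        DistancesSharp (cssCode (dualCode (xlCode ht α β 2 1)) (xlCode ht α β m l)) dz 3 := by
  have hm : 3 ≤ m := by omega
  have hmq : m + 1 ≤ q := by omega
  have hl : l + 1 ≤ m := by omega
  refine ⟨exists_isXLListing hq hK, fun α β h => ?_⟩
  have hd1 := finrank_xlCode hq hK h ht (m := 2) (l := 1) (by omega) (by omega)
  have hd2 := finrank_xlCode hq hK h ht hmq hl
  -- The smaller code has dimension 3, so this makes the inclusion strict.
  have hm3 : 3 ≤ m * (m - 1) / 2 := by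
    rw [Nat.le_div_iff_mul_le two_pos]
    exact Nat.mul_le_mul hm (by omega)
  have hlt : xlCode ht α β 2 1 < xlCode ht α β m l := by
    refine lt_of_le_of_ne (xlCode_mono ht hm) fun e => ?_
    rw [e, hd2] at hd1
    omega
  have hex : ∃ d, ∃ u ∈ xlCode ht α β m l, u ∉ xlCode ht α β 2 1 ∧ hammingNorm u = d := by
    obtain ⟨u, hu, hu'⟩ := SetLike.exists_of_lt hlt
    exact ⟨_, u, hu, hu', rfl⟩
  classical
  have hdz : IsRelMinWeight (xlCode ht α β m l) (xlCode ht α β 2 1) (Nat.find hex) :=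
    ⟨Nat.find_spec hex, fun d hd => Nat.find_min' hex hd⟩
  obtain ⟨τ, ν, hτν⟩ := exists_isTraceNorm hq hK ht α β
  have hdx : IsRelMinWeight (dualCode (xlCode ht α β 2 1)) (dualCode (xlCode ht α β m l)) 3 := by
    refine ⟨exists_weight_three hq hK h hm (by omega) hτν, ?_⟩
    rintro _ ⟨u, hu, hu', rfl⟩
    refine hτν.three_le_hammingNorm hq hK h hu ?_
    rintro rfl
    exact hu' (Submodule.zero_mem _)
  refine ⟨hlt, Nat.find hex, ?_, hdz, hdx, ?_⟩
  · obtain ⟨u, hu, hu', hw⟩ := hdz.1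
    rw [← hw]
    refine xlDelta_le_hammingNorm hq hK h ht (by omega) hl (by omega) hu ?_
    rintro rfl
    exact hu' (Submodule.zero_mem _)
  · refine isAQC_and_distancesSharp_cssCode (dualCode_anti hlt.le) ?_
      (by rwa [dualCode_dualCode]) hdx
    -- Needed for the truncated difference (n - 3) - (n - dim C₂) to equal dim C₂ - 3.
    have hn : Module.finrank F (xlCode ht α β m l) ≤ t + (q ^ 2 - q) / 2 := by
      simpa using Submodule.finrank_le (xlCode ht α β m l)
    rw [finrank_dualCode, finrank_dualCode, hd1]
    rw [hd2] at hn ⊢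
    omega
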